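/- A pure Boolean-algebra sentence $F_0$ is built from atoms $b_1=b_2$, $b_1\subseteq b_2$ (where $b_i$ are terms over set variables, $\emptyset$, $\mathcal U$, $\cup$, $\cap$, ${}^c$) by $\land,\lor,\lnot$ and quantifiers over set variables. Let $n$ be its size (number of symbols) and $S$ its number of set variables, distinct quantifiers binding distinct variables. Let $\alpha(F_0)$ be the following Presburger sentence in the constant $\mathrm{MAXC}$ (the size of the finite universe). Bring $F_0$ into prenex form $Q_S x_S\cdots Q_1x_1.\,F$. Replace $b_1\subseteq b_2$ by $|b_1\cap b_2^c|=0$, and $b_1=b_2$ by the conjunction of the two inclusions so translated; replace each $|b|$ by the sum of the variables $l_s$ over the cubes $s$ of $x_S,\dots,x_1$ contained in $b$. This gives $G_1$. For $r=1,\dots,S$ let $G_{r+1}$ be $$\exists^+ (l_s)_s.\ \Big(\bigwedge_{s'} l_{s'}=l_{s'\cap x_r^c}+l_{s'\cap x_r}\Big)\land G_r \quad\text{if } Q_r=\exists,\qquad \forall^+ (l_s)_s.\ \Big(\bigwedge_{s'} l_{s'}=l_{s'\cap x_r^c}+l_{s'\cap x_r}\Big)\Rightarrow G_r\quad\text{if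 } Q_r=\forall,$$ where $s$ ranges over the cubes of $x_S,\dots,x_r$, $s'$ over the cubes of $x_S,\dots,x_{r+1}$, and $\exists^+,\forall^+$ are quantifiers over nonnegative integers. Finally $\alpha(F_0)=G_{S+1}(\mathrm{MAXC})$. **Theorem.** (1) For every pure Boolean-algebra sentence $F_0$, every $1\le r\le S+1$ and all nonnegative integers $w_1,\dots,w_q$ ($q=2^{S+1-r}$), $$G_r(w_1,\dots,w_q)\iff G_r(\bar w_1,\dots,\bar w_q),\qquad \bar w_i=\min(w_i,2^{r-1}).$$ In particular $\alpha(F_0)$ has the same truth value for $\mathrm{MAXC}=N$ and for $\mathrm{MAXC}=\min(N,2^S)$. (2) The truth value of $\alpha(F_0)$ can be computed in space $O(nS2^S)$, hence in space $2^{O(n)}$ (where $S$ is read as $1$ in the first bound if $F_0$ has no variables). Precisely, there are a constant $C$ and two deterministic Turing machines with finitely many stacks over finite alphabets, such that, counting all occupied cells including those of the input: the first machine, on input $F_0$, decides whether $\alpha(F_0)$ is true for every value $N\ge 0$ of $\mathrm{MAXC}$, in space at most $C\,n\max(S,1)\,2^S$ and at most $2^{Cn}$; the second machine, on input $F_0$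 and $N$ in binary with bit length $|N|$, decides whether $\alpha(F_0)$ is true for $\mathrm{MAXC}=N$, in space at most $C\,(n\max(S,1)\,2^S+|N|)$ and at most $2^{Cn}+C|N|$. -/

import Mathlib

namespace BAPA

/-! ### Pure Boolean-algebra formulas -/

/-- Boolean-algebra terms over the set variables `V`. -/
inductive SetTerm (V : Type) : Type
  | var (x : V)
  | empty
  | univ
  | union (a b : SetTerm V)
  | inter (a b : SetTerm V)
  | compl (a : SetTerm V)

namespace SetTerm

def map {V W : Type} (f : V → W) : SetTerm V → SetTerm W
  | var x => var (f x)
  | empty => empty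
  | univ => univ
  | union a b => union (a.map f) (b.map f)
  | inter a b => inter (a.map f) (b.map f)
  | compl a => compl (a.map f)

/-- Number of symbols; an occurrence of a variable is one symbol. -/
def size {V : Type} : SetTerm V → ℕ
  | var _ => 1
  | empty => 1
  | univ => 1
  | union a b => a.size + b.size + 1
  | inter a b => a.size + b.size + 1
  | compl a => a.size + 1

/-- If `c x` says whether a given cube (a nonempty intersection of variables and complements of
variables, every variable occurring) lies inside `x` rather than inside `xᶜ`,
then `a.contains c` says whether that cube lies inside `a` rather than inside `aᶜ`. -/
def contains {V : Type} (c : V → Bool) : SetTerm V → Bool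
  | var x => c x
  | empty => false
  | univ => true
  | union a b => a.contains c || b.contains c
  | inter a b => a.contains c && b.contains c
  | compl a => !a.contains c

end SetTerm

/-- Pure Boolean-algebra formulas with free set variables `0, …, m - 1`. The variable bound by a
quantifier standing in the scope of variables `0, …, m - 1` is the variable `m`
(so two nested quantifiers never bind the same variable). Sentences are `BAFormula 0`. -/
inductive BAFormula : ℕ → Type
  | eq {m : ℕ} (a b : SetTerm (Fin m)) : BAFormula m
  | subset {m : ℕ} (a b : SetTerm (Fin m)) : BAFormula m
  | and {m : ℕ} (F G : BAFormula m) : BAFormula m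
  | or {m : ℕ} (F G : BAFormula m) : BAFormula m
  | not {m : ℕ} (F : BAFormula m) : BAFormula m
  | ex {m : ℕ} (F : BAFormula (m + 1)) : BAFormula m
  | all {m : ℕ} (F : BAFormula (m + 1)) : BAFormula m

namespace BAFormula

/-- The size of a formula: its number of symbols. -/
def size : {m : ℕ} → BAFormula m → ℕ
  | _, eq a b => a.size + b.size + 1
  | _, subset a b => a.size + b.size + 1
  | _, and F G => F.size + G.size + 1
  | _, or F G => F.size + G.size + 1
  | _, not F => F.size + 1
  | _, ex F => F.size + 1
  | _, all F => F.size + 1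

/-- The number of (bound) set variables, distinct quantifiers being understood to bind distinct
variables. -/
def numVars : {m : ℕ} → BAFormula m → ℕ
  | _, eq _ _ => 0
  | _, subset _ _ => 0
  | _, and F G => F.numVars + G.numVars
  | _, or F G => F.numVars + G.numVars
  | _, not F => F.numVars
  | _, ex F => F.numVars + 1
  | _, all F => F.numVars + 1

end BAFormula

/-! ### Prenex form -/

/-- Quantifier-free pure Boolean-algebra formulas. -/
inductive QFree (V : Type) : Type
  | eq (a b : SetTerm V)
  | subset (a b : SetTerm V)
  | and (F G : QFree V)
  | or (F G : QFree V)
  | not (F : QFree V)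

def QFree.map {V W : Type} (f : V → W) : QFree V → QFree W
  | eq a b => eq (a.map f) (b.map f)
  | subset a b => subset (a.map f) (b.map f)
  | and F G => and (F.map f) (G.map f)
  | or F G => or (F.map f) (G.map f)
  | not F => not (F.map f)

inductive Quant : Type
  | ex
  | all

def Quant.dual : Quant → Quant
  | ex => all
  | all => ex

/-- Prenex formulas with free variables `0, …, m - 1` and `p` quantifiers: `quant 0` is the
outermost quantifier, and `quant i` binds the variable `m + i`. -/
structure Prenex (m p : ℕ) : Type where
  quant : Fin p → Quant
  matrix : QFree (Fin (m + p))

/-- Variables of the first of two formulas whose quantifiers are pulled out, the first formula's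
quantifiers outermost. -/
def leftVar (m p q : ℕ) : Fin (m + p) → Fin (m + (p + q)) :=
  Fin.castLE (by omega)

/-- Variables of the second of two formulas whose quantifiers are pulled out: its free variables
stay, its bound variables move past the `p` bound variables of the first formula. -/
def rightVar (m p q : ℕ) : Fin (m + q) → Fin (m + (p + q)) :=
  Fin.addCases (fun i => Fin.castAdd (p + q) i) (fun j => Fin.natAdd m (Fin.natAdd p j))

/-- Transformation into prenex form. -/
def BAFormula.prenex : {m : ℕ} → (F : BAFormula m) → Prenex m F.numVars
  | _, .eq a b => ⟨Fin.elim0, .eq a b⟩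
  | _, .subset a b => ⟨Fin.elim0, .subset a b⟩
  | _, .and F G =>
      ⟨Fin.append F.prenex.quant G.prenex.quant,
        .and (F.prenex.matrix.map (leftVar _ _ _)) (G.prenex.matrix.map (rightVar _ _ _))⟩
  | _, .or F G =>
      ⟨Fin.append F.prenex.quant G.prenex.quant,
        .or (F.prenex.matrix.map (leftVar _ _ _)) (G.prenex.matrix.map (rightVar _ _ _))⟩
  | _, .not F => ⟨fun i => (F.prenex.quant i).dual, .not F.prenex.matrix⟩
  | m, .ex F =>
      ⟨Fin.cons .ex F.prenex.quant,
        F.prenex.matrix.map (Fin.cast (Nat.add_right_comm m 1 F.numVars))⟩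
  | m, .all F =>
      ⟨Fin.cons .all F.prenex.quant,
        F.prenex.matrix.map (Fin.cast (Nat.add_right_comm m 1 F.numVars))⟩

/-! ### Presburger arithmetic -/

/-- Linear integer terms; `maxcard` is the constant denoting the size of the finite universe. -/
inductive PATerm : Type
  | var (x : ℕ)
  | const (c : ℤ)
  | maxcard
  | add (s t : PATerm)
  | sub (s t : PATerm)
  | smul (c : ℤ) (t : PATerm)

/-- Formulas of Presburger arithmetic, with named integer variables. -/
inductive PAFormula : Type
  | eq (s t : PATerm)
  | lt (s t : PATerm)
  | dvd (c : ℤ) (t : PATerm)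
  | and (F G : PAFormula)
  | or (F G : PAFormula)
  | not (F : PAFormula)
  | ex (x : ℕ) (F : PAFormula)
  | all (x : ℕ) (F : PAFormula)

/-- Value of a term when `maxcard` is `N` and the variables are given by `v`. -/
def PATerm.eval (N : ℕ) (v : ℕ → ℤ) : PATerm → ℤ
  | var x => v x
  | const c => c
  | maxcard => N
  | add s t => s.eval N v + t.eval N v
  | sub s t => s.eval N v - t.eval N v
  | smul c t => c * t.eval N v

/-- Truth over the integers when `maxcard` is `N` and the free variables are given by `v`. -/
def PAFormula.Holds (N : ℕ) : (ℕ → ℤ) → PAFormula → Prop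
  | v, eq s t => s.eval N v = t.eval N v
  | v, lt s t => s.eval N v < t.eval N v
  | v, dvd c t => c ∣ t.eval N v
  | v, and F G => F.Holds N v ∧ G.Holds N v
  | v, or F G => F.Holds N v ∨ G.Holds N v
  | v, not F => ¬ F.Holds N v
  | v, ex x F => ∃ z : ℤ, F.Holds N (Function.update v x z)
  | v, all x F => ∀ z : ℤ, F.Holds N (Function.update v x z)

/-- Truth of a sentence when `maxcard` is `N`. (The truth value of a sentence does not depend on
the valuation.) -/
def PAFormula.TrueAt (N : ℕ) (F : PAFormula) : Prop :=
  ∀ v : ℕ → ℤ, F.Holds N v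

/-- Substitution of `maxcard` for the variable `x`. -/
def PATerm.substMax (x : ℕ) : PATerm → PATerm
  | var y => if y = x then maxcard else var y
  | const c => const c
  | maxcard => maxcard
  | add s t => add (s.substMax x) (t.substMax x)
  | sub s t => sub (s.substMax x) (t.substMax x)
  | smul c t => smul c (t.substMax x)

/-- Substitution of `maxcard` for the free occurrences of the variable `x`. -/
def PAFormula.substMax (x : ℕ) : PAFormula → PAFormula
  | eq s t => eq (s.substMax x) (t.substMax x)
  | lt s t => lt (s.substMax x) (t.substMax x)
  | dvd c t => dvd c (t.substMax x)
  | and F G => and (F.substMax x) (G.substMax x)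
  | or F G => or (F.substMax x) (G.substMax x)
  | not F => not (F.substMax x)
  | ex y F => if y = x then ex y F else ex y (F.substMax x)
  | all y F => if y = x then all y F else all y (F.substMax x)

namespace PAFormula

/-- Implication as an abbreviation. -/
def imp (F G : PAFormula) : PAFormula := or (not F) G

/-- `x ≥ 0`. -/
def nonneg (x : ℕ) : PAFormula := not (lt (.var x) (.const 0))

/-- Quantifier `∃⁺ x`, over the nonnegative integers. -/
def exNat (x : ℕ) (F : PAFormula) : PAFormula := ex x (and (nonneg x) F)

/-- Quantifier `∀⁺ x`, over the nonnegative integers. -/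
def allNat (x : ℕ) (F : PAFormula) : PAFormula := all x (imp (nonneg x) F)

end PAFormula

/-! ### The algorithm `α`

Cubes are numbered as follows: the only cube of no variables (the universe) has number `1`; if a
cube `s` of the first `e` variables has number `j`, and `y` is the next variable, then `s ∩ yᶜ` has
number `2 * j` and `s ∩ y` has number `2 * j + 1`. So the cubes of the first `e` variables are
numbered `2 ^ e, …, 2 ^ (e + 1) - 1`. The integer variable `j` stands for the cardinality of the
cube with number `j`. -/

/-- The cubes of the first `e` variables. -/
def cubes (e : ℕ) : List ℕ := List.range' (2 ^ e) (2 ^ e)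

/-- Whether the cube of `S` variables with number `j` lies inside the variable `i`. -/
def cubeIn (S j : ℕ) (i : Fin S) : Bool := j.testBit (S - 1 - i)

/-- The cardinality of `b`, written as the sum of the cardinalities of the cubes inside `b`. -/
def cardTerm {S : ℕ} (b : SetTerm (Fin S)) : PATerm :=
  ((cubes S).filter fun j => b.contains (cubeIn S j)).foldr
    (fun j t => .add (.var j) t) (.const 0)

/-- The formula `|b| = 0`. -/
def cardZero {S : ℕ} (b : SetTerm (Fin S)) : PAFormula := .eq (cardTerm b) (.const 0)

/-- Translation of a quantifier-free formula: `a ⊆ b` becomes `|a ∩ bᶜ| = 0`, and `a = b` becomes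
the conjunction of two inclusions. -/
def QFree.translate {S : ℕ} : QFree (Fin S) → PAFormula
  | eq a b => .and (cardZero (.inter a (.compl b))) (cardZero (.inter b (.compl a)))
  | subset a b => cardZero (.inter a (.compl b))
  | and F G => .and F.translate G.translate
  | or F G => .or F.translate G.translate
  | not F => .not F.translate

/-- The conjunction of the equations `l'ⱼ = l₂ⱼ + l₂ⱼ₊₁` over the cubes `j` of the first `e`
variables. -/
def splitEqs (e : ℕ) : PAFormula :=
  (cubes e).foldr
    (fun j F => .and (.eq (.var j) (.add (.var (2 * j)) (.var (2 * j + 1)))) F)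
    (.eq (.const 0) (.const 0))

/-- Elimination of a quantifier over the set variable number `e`, in whose scope the formula has
been reduced to `G`. -/
def elimSet (e : ℕ) (G : PAFormula) : Quant → PAFormula
  | .ex => (cubes (e + 1)).foldr PAFormula.exNat (.and (splitEqs e) G)
  | .all => (cubes (e + 1)).foldr PAFormula.allNat (.imp (splitEqs e) G)

/-- `P.stage t` is the formula obtained when the `t` innermost quantifiers have been eliminated
(usually called `G_{t+1}`); its free variables are the `2 ^ (S - t)` variables standing for the
cubes of the first `S - t` set variables. -/
def Prenex.stage {S : ℕ} (P : Prenex 0 S) : ℕ → PAFormula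
  | 0 => (P.matrix.map (Fin.cast (Nat.zero_add S))).translate
  | t + 1 =>
      if h : t < S then elimSet (S - 1 - t) (P.stage t) (P.quant ⟨S - 1 - t, by omega⟩)
      else P.stage t

/-- The Presburger arithmetic sentence `α(F)`: the last stage, with `maxcard` for its only free
variable. -/
def alpha (F : BAFormula 0) : PAFormula :=
  (F.prenex.stage F.numVars).substMax 1

/-! ### Input words -/

/-- The input alphabet. -/
inductive Sym : Type
  | var | tick
  | empty | univ | union | inter | compl
  | eq | subset
  | and | or | not
  | ex | all
  | bit (b : Bool)

/-- Terms in Polish notation; the variable `i` is the symbol `var` followed by `i` ticks. -/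
def SetTerm.encode {m : ℕ} : SetTerm (Fin m) → List Sym
  | var x => Sym.var :: List.replicate x Sym.tick
  | empty => [Sym.empty]
  | univ => [Sym.univ]
  | union a b => Sym.union :: (a.encode ++ b.encode)
  | inter a b => Sym.inter :: (a.encode ++ b.encode)
  | compl a => Sym.compl :: a.encode

/-- Formulas in Polish notation. -/
def BAFormula.encode : {m : ℕ} → BAFormula m → List Sym
  | _, eq a b => Sym.eq :: (a.encode ++ b.encode)
  | _, subset a b => Sym.subset :: (a.encode ++ b.encode)
  | _, and F G => Sym.and :: (F.encode ++ G.encode)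
  | _, or F G => Sym.or :: (F.encode ++ G.encode)
  | _, not F => Sym.not :: F.encode
  | _, ex F => Sym.ex :: F.encode
  | _, all F => Sym.all :: F.encode

/-- Binary notation, least significant bit first. -/
def encodeNat (N : ℕ) : List Sym := N.bits.map Sym.bit

/-! ### Space-bounded Turing machines

Machines are Mathlib's deterministic Turing machines with finitely many stacks. -/

/-- A machine with input alphabet `Sym` that answers with a truth value. -/
abbrev Machine : Type 1 := Turing.TM2ComputableAux Sym Bool

/-- All stack alphabets are finite. -/
def Machine.FiniteAlphabets (M : Machine) : Prop := ∀ k, Finite (M.tm.Γ k)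

/-- The initial configuration on the input word `x`. -/
def Machine.init (M : Machine) (x : List Sym) : M.tm.Cfg :=
  Turing.initList M.tm (x.map M.inputAlphabet.symm)

/-- On the input word `x` the machine halts with the one-letter word `b` as output. -/
def Machine.Answers (M : Machine) (x : List Sym) (b : Bool) : Prop :=
  Nonempty (Turing.TM2Outputs M.tm (x.map M.inputAlphabet.symm)
    (some ([b].map M.outputAlphabet.symm)))

/-- On the input word `x` the machine halts and answers whether `P` is true. -/
def Machine.Decides (M : Machine) (x : List Sym) (P : Prop) : Prop :=
  (P → M.Answers x true) ∧ (¬ P → M.Answers x false)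

/-- The number of cells occupied in a configuration, on all stacks, the input stack included. -/
def Machine.cells (M : Machine) (c : M.tm.Cfg) : ℕ :=
  letI := M.tm.kFin
  ∑ k, (c.stk k).length

/-- In the run on the input word `x`, no configuration occupies more than `s` cells. -/
def Machine.RunsInSpace (M : Machine) (x : List Sym) (s : ℕ) : Prop :=
  ∀ c : M.tm.Cfg, StateTransition.Reaches M.tm.step (M.init x) c → M.cells c ≤ s

end BAPA

/-! ### Capping: a stage sees cardinalities only up to a threshold. -/

namespace BAPA

/-! ### Bounded quantification -/

/-! Capping is a back-and-forth argument. The matrix only asks which cubes are empty, so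
cardinalities matter up to 1. Eliminating a quantifier splits every cube in two. If two totals agree
up to `2 * T`, each splitting of one is matched by a splitting of the other whose parts agree up to
`T` (`exists_split_of_min_eq`): totals below `2 * T` are equal, and otherwise some part is at least
`T` and can absorb the difference. The threshold therefore doubles with each quantifier, which gives
`2 ^ t` after `t` of them (`Prenex.holds_stage_congr_of_min_eq`).

For the space bounds the Presburger sentence is never evaluated. A splitting of the cardinalities of
all cubes is the same thing as a choice of one more subset of the universe, so `alpha F` at `N` is
true exactly when `F` is true of the subsets of an `N`-element set (`trueAt_alpha_iff_sat`). By
capping, only `N ≤ 2 ^ S` has to be considered, and for such `N` the formula `F` can be evaluated by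
brute force.

The evaluator keeps one column of bits per element, telling to which of the sets in scope the
element belongs. A set quantifier adds a bit to each column and runs through all subsets by binary
counting across the columns; an atom runs through the elements. The columns take at most `N * (S +
1)` cells, the text of the formula at most `n * max S 1` because variables are written in unary, and
the control stack `O(n)`. The sum is `O(n * max S 1 * 2 ^ S)`. The first machine tries all `N ≤ 2 ^
S`; the second first replaces `N` by `min N (2 ^ S)`.

Programs are written in a small structured language whose executions carry a bound on occupied
cells. `Run.path` translates an execution into a machine run under the same bound. Since the machine
is deterministic and halts, this run contains every reachable configuration (`Path.cells_le`). The
programs are verified with weakest preconditions, the central invariants being `Evaluates`,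
`wp_eval_elements` and `wp_eval_sets`. -/

/-- Quantification of `B` relative to `A`. -/
def Quant.sat {α : Type} (q : Quant) (A B : α → Prop) : Prop :=
  match q with
  | .ex => ∃ x, A x ∧ B x
  | .all => ∀ x, A x → B x

/-- One back-and-forth principle serves both quantifiers. It is used for capping and again for
exchanging splittings of cardinalities with sets. -/
theorem Quant.sat_iff {α β : Type} {q : Quant} {A B : α → Prop} {A' B' : β → Prop}
    (h : ∀ x, A x → ∃ y, A' y ∧ (B x ↔ B' y)) (h' : ∀ y, A' y → ∃ x, A x ∧ (B x ↔ B' y)) :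
    q.sat A B ↔ q.sat A' B' := by
  cases q
  · constructor
    · rintro ⟨x, hx, hB⟩
      obtain ⟨y, hy, e⟩ := h x hx
      exact ⟨y, hy, e.1 hB⟩
    · rintro ⟨y, hy, hB⟩
      obtain ⟨x, hx, e⟩ := h' y hy
      exact ⟨x, hx, e.2 hB⟩
  · constructor
    · intro H y hy
      obtain ⟨x, hx, e⟩ := h' y hy
      exact e.1 (H x hx)
    · intro H x hx
      obtain ⟨y, hy, e⟩ := h x hx
      exact e.2 (H y hy)

theorem Quant.sat_congr {α : Type} {q : Quant} {A B A' B' : α → Prop}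
    (h : ∀ x, A x ↔ A' x) (h' : ∀ x, A x → (B x ↔ B' x)) : q.sat A B ↔ q.sat A' B' :=
  Quant.sat_iff (fun x hx => ⟨x, (h x).1 hx, h' x hx⟩)
    (fun x hx => ⟨x, (h x).2 hx, h' x ((h x).2 hx)⟩)

/-! ### Cubes -/

theorem mem_cubes {e j : ℕ} : j ∈ cubes e ↔ 2 ^ e ≤ j ∧ j < 2 ^ (e + 1) := by
  rw [cubes, List.mem_range'_1, pow_succ]; omega

theorem nodup_cubes (e : ℕ) : (cubes e).Nodup := List.nodup_range'

theorem two_mul_mem_cubes {e j : ℕ} : 2 * j ∈ cubes (e + 1) ↔ j ∈ cubes e := by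
  rw [mem_cubes, mem_cubes, pow_succ 2 (e + 1), pow_succ]; omega

theorem two_mul_add_one_mem_cubes {e j : ℕ} : 2 * j + 1 ∈ cubes (e + 1) ↔ j ∈ cubes e := by
  rw [mem_cubes, mem_cubes, pow_succ 2 (e + 1), pow_succ]; omega

theorem forall_mem_cubes_succ {e : ℕ} {p : ℕ → Prop} :
    (∀ i ∈ cubes (e + 1), p i) ↔ ∀ j ∈ cubes e, p (2 * j) ∧ p (2 * j + 1) := by
  constructor
  · exact fun h j hj => ⟨h _ (two_mul_mem_cubes.2 hj), h _ (two_mul_add_one_mem_cubes.2 hj)⟩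
  · intro h i hi
    rcases Nat.even_or_odd' i with ⟨j, rfl | rfl⟩
    · exact (h j (two_mul_mem_cubes.1 hi)).1
    · exact (h j (two_mul_add_one_mem_cubes.1 hi)).2

/-! ### Truth of the stages -/

namespace PAFormula

theorem holds_exNat {N : ℕ} {v : ℕ → ℤ} {x : ℕ} {G : PAFormula} :
    (exNat x G).Holds N v ↔ ∃ n : ℕ, G.Holds N (Function.update v x n) := by
  simp only [exNat, Holds, nonneg, PATerm.eval, Function.update_self, not_lt]
  constructor
  · rintro ⟨z, hz, h⟩
    lift z to ℕ using hz
    exact ⟨z, h⟩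
  · rintro ⟨n, h⟩
    exact ⟨n, by positivity, h⟩

theorem holds_allNat {N : ℕ} {v : ℕ → ℤ} {x : ℕ} {G : PAFormula} :
    (allNat x G).Holds N v ↔ ∀ n : ℕ, G.Holds N (Function.update v x n) := by
  simp only [allNat, imp, Holds, nonneg, PATerm.eval, Function.update_self, not_lt,
    not_le]
  constructor
  · exact fun h n => (h n).resolve_left (by simp)
  · intro h z
    by_cases hz : z < 0
    · exact Or.inl hz
    · lift z to ℕ using not_lt.1 hz
      exact Or.inr (h z)

/-- Overriding a valuation on the variables in `L`. -/
def overrideOn (L : List ℕ) (l : ℕ → ℕ) (v : ℕ → ℤ) : ℕ → ℤ :=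
  fun j => if j ∈ L then (l j : ℤ) else v j

theorem overrideOn_nil (l : ℕ → ℕ) (v : ℕ → ℤ) : overrideOn [] l v = v := by
  funext j
  simp [overrideOn]

theorem overrideOn_update {L : List ℕ} {l : ℕ → ℕ} {v : ℕ → ℤ} {x n : ℕ} (hx : x ∉ L) :
    overrideOn L l (Function.update v x n) = overrideOn (x :: L) (Function.update l x n) v := by
  funext j
  simp only [overrideOn, List.mem_cons, Function.update_apply]
  split_ifs <;> simp_all

theorem exists_overrideOn_cons {L : List ℕ} {v : ℕ → ℤ} {x : ℕ} (hx : x ∉ L)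
    {p : (ℕ → ℤ) → Prop} :
    (∃ l, p (overrideOn (x :: L) l v)) ↔
      ∃ (n : ℕ) (l : ℕ → ℕ), p (overrideOn L l (Function.update v x n)) := by
  constructor
  · rintro ⟨l, h⟩
    refine ⟨l x, l, ?_⟩
    rwa [overrideOn_update hx, Function.update_eq_self]
  · rintro ⟨n, l, h⟩
    exact ⟨Function.update l x n, overrideOn_update hx ▸ h⟩

/-- Without repetitions no variable is bound twice, so the block amounts to one quantifier over
functions, of which only the values on `L` matter. -/
theorem holds_foldr_exNat {N : ℕ} {G : PAFormula} {L : List ℕ} (hL : L.Nodup) {v : ℕ → ℤ} :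
    (L.foldr exNat G).Holds N v ↔ ∃ l : ℕ → ℕ, G.Holds N (overrideOn L l v) := by
  induction L generalizing v with
  | nil => simp [overrideOn_nil]
  | cons x L ih =>
    rw [List.nodup_cons] at hL
    rw [List.foldr_cons, holds_exNat, exists_overrideOn_cons hL.1 (p := fun v => G.Holds N v)]
    simp only [ih hL.2]

theorem holds_foldr_allNat {N : ℕ} {G : PAFormula} {L : List ℕ} (hL : L.Nodup) {v : ℕ → ℤ} :
    (L.foldr allNat G).Holds N v ↔ ∀ l : ℕ → ℕ, G.Holds N (overrideOn L l v) := by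
  induction L generalizing v with
  | nil => simp [overrideOn_nil]
  | cons x L ih =>
    rw [List.nodup_cons] at hL
    rw [List.foldr_cons, holds_allNat, ← not_iff_not, not_forall, not_forall,
      exists_overrideOn_cons hL.1 (p := fun v => ¬ G.Holds N v)]
    simp only [ih hL.2, not_forall]

theorem holds_splitEqs {N e : ℕ} {v : ℕ → ℤ} :
    (splitEqs e).Holds N v ↔ ∀ j ∈ cubes e, v j = v (2 * j) + v (2 * j + 1) := by
  rw [splitEqs]
  induction cubes e with
  | nil => simp [Holds]
  | cons x L ih => simp [Holds, PATerm.eval, ih]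

/-- Truth of `G` is determined by the values of the variables for the cubes of the first `e`
set variables. -/
def OverCubes (e : ℕ) (G : PAFormula) : Prop :=
  ∀ (N : ℕ) (v v' : ℕ → ℤ), (∀ j ∈ cubes e, v j = v' j) → (G.Holds N v ↔ G.Holds N v')

/-- The numbers of the cubes of `e` and of `e + 1` variables form disjoint intervals. Hence the
quantified values leave the left sides of the splitting equations alone, while `G` sees nothing but
these values. -/
theorem holds_elimSet {N e : ℕ} {G : PAFormula} (hG : G.OverCubes (e + 1)) {q : Quant}
    {v : ℕ → ℤ} : (elimSet e G q).Holds N v ↔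
      q.sat (fun l : ℕ → ℕ => ∀ j ∈ cubes e, v j = l (2 * j) + l (2 * j + 1))
        (fun l => G.Holds N fun j => (l j : ℤ)) := by
  have hs (l : ℕ → ℕ) : (splitEqs e).Holds N (overrideOn (cubes (e + 1)) l v) ↔
      ∀ j ∈ cubes e, v j = l (2 * j) + l (2 * j + 1) := by
    rw [holds_splitEqs]
    refine forall₂_congr fun j hj => ?_
    have : j ∉ cubes (e + 1) := by rw [mem_cubes] at hj ⊢; omega
    simp [overrideOn, two_mul_mem_cubes.2 hj, two_mul_add_one_mem_cubes.2 hj, this]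
  have hg (l : ℕ → ℕ) : G.Holds N (overrideOn (cubes (e + 1)) l v) ↔
      G.Holds N fun j => (l j : ℤ) :=
    hG _ _ _ fun j hj => by simp [overrideOn, hj]
  cases q
  · simp only [elimSet, holds_foldr_exNat (nodup_cubes _), Holds, hs, hg, Quant.sat]
  · simp only [elimSet, holds_foldr_allNat (nodup_cubes _), imp, Holds, hs, hg, Quant.sat,
      imp_iff_not_or]

theorem OverCubes.elimSet {e : ℕ} {G : PAFormula} (hG : G.OverCubes (e + 1)) (q : Quant) :
    (elimSet e G q).OverCubes e := by
  intro N v v' h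
  rw [holds_elimSet hG, holds_elimSet hG]
  exact Quant.sat_congr (fun l => forall₂_congr fun j hj => by rw [h j hj]) fun _ _ => Iff.rfl

end PAFormula

open PAFormula

theorem eval_sumTerm {N : ℕ} {v : ℕ → ℤ} (L : List ℕ) :
    (L.foldr (fun j t => PATerm.add (.var j) t) (.const 0)).eval N v = (L.map v).sum := by
  induction L with
  | nil => rfl
  | cons x L ih => simp [PATerm.eval, ih]

theorem overCubes_cardZero {S : ℕ} (b : SetTerm (Fin S)) : (cardZero b).OverCubes S := by
  intro N v v' h
  simp only [cardZero, Holds, cardTerm, eval_sumTerm, PATerm.eval]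
  rw [List.map_congr_left fun j hj => h j (List.mem_filter.1 hj).1]

/-- A sum of nonnegative integers vanishes only if every summand does; this is why the valuation
comes from natural numbers. -/
theorem holds_cardZero {S N : ℕ} {b : SetTerm (Fin S)} {w : ℕ → ℕ} :
    (cardZero b).Holds N (fun j => (w j : ℤ)) ↔
      ∀ j ∈ cubes S, b.contains (cubeIn S j) → w j = 0 := by
  simp only [cardZero, Holds, cardTerm, eval_sumTerm, PATerm.eval]
  generalize cubes S = L
  induction L with
  | nil => simp
  | cons x L ih =>
    by_cases hx : b.contains (cubeIn S x)
    · have : 0 ≤ (List.map (fun j => (w j : ℤ))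
          (List.filter (fun j => b.contains (cubeIn S j)) L)).sum :=
        List.sum_nonneg fun z hz => by
          obtain ⟨j, -, rfl⟩ := List.mem_map.1 hz
          positivity
      simp only [List.filter_cons, hx, if_true, List.map_cons, List.sum_cons, List.forall_mem_cons,
        ← ih, forall_const]
      omega
    · simpa [List.filter_cons, hx] using ih

theorem overCubes_translate {S : ℕ} (Q : QFree (Fin S)) : Q.translate.OverCubes S := by
  intro N v v' h
  induction Q with
  | eq a b =>
    exact and_congr (overCubes_cardZero _ N v v' h) (overCubes_cardZero _ N v v' h)
  | subset a b => exact overCubes_cardZero _ N v v' h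
  | and F G hF hG => exact and_congr hF hG
  | or F G hF hG => exact or_congr hF hG
  | not F hF => exact not_congr hF

theorem Prenex.overCubes_stage {S : ℕ} (P : Prenex 0 S) {t : ℕ} (ht : t ≤ S) :
    (P.stage t).OverCubes (S - t) := by
  induction t with
  | zero => exact overCubes_translate _
  | succ t ih =>
    have h : t < S := ht
    have e : S - t = S - 1 - t + 1 := by omega
    rw [Prenex.stage, dif_pos h, show S - (t + 1) = S - 1 - t by omega]
    exact OverCubes.elimSet (e ▸ ih h.le) _

theorem Prenex.holds_stage_succ {S N : ℕ} (P : Prenex 0 S) {t : ℕ} (ht : t < S) {w : ℕ → ℕ} :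
    (P.stage (t + 1)).Holds N (fun j => (w j : ℤ)) ↔
      (P.quant ⟨S - 1 - t, by omega⟩).sat
        (fun l : ℕ → ℕ => ∀ j ∈ cubes (S - 1 - t), w j = l (2 * j) + l (2 * j + 1))
        (fun l => (P.stage t).Holds N fun j => (l j : ℤ)) := by
  have e : S - t = S - 1 - t + 1 := by omega
  rw [Prenex.stage, dif_pos ht, holds_elimSet (e ▸ P.overCubes_stage ht.le)]
  exact Quant.sat_congr (fun l => forall₂_congr fun j _ => by norm_cast) fun _ _ => Iff.rfl

/-! ### Capping -/

/-- Base case of capping: the matrix only distinguishes empty from nonempty cubes, which is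
agreement up to `2 ^ 0`. -/
theorem holds_translate_congr {S N : ℕ} (Q : QFree (Fin S)) {w w' : ℕ → ℕ}
    (h : ∀ j ∈ cubes S, (w j = 0 ↔ w' j = 0)) :
    Q.translate.Holds N (fun j => (w j : ℤ)) ↔ Q.translate.Holds N (fun j => (w' j : ℤ)) := by
  have hz (b : SetTerm (Fin S)) : (cardZero b).Holds N (fun j => (w j : ℤ)) ↔
      (cardZero b).Holds N (fun j => (w' j : ℤ)) := by
    rw [holds_cardZero, holds_cardZero]
    exact forall₂_congr fun j hj => by rw [h j hj]
  induction Q with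
  | eq a b => exact and_congr (hz _) (hz _)
  | subset a b => exact hz _
  | and F G hF hG => exact and_congr hF hG
  | or F G hF hG => exact or_congr hF hG
  | not F hF => exact not_congr hF

/-- The arithmetic core. A total below `2 * T` equals `w'` and is split as before. Otherwise `w' ≥ 2
* T`: a part smaller than `T` is kept and the rest still reaches `T`; if neither part is small, `T`
and `w' - T` will do. -/
theorem exists_split_of_min_eq {T a b w' : ℕ} (h : min (a + b) (2 * T) = min w' (2 * T)) :
    ∃ a' b', w' = a' + b' ∧ min a T = min a' T ∧ min b T = min b' T := by
  by_cases h1 : a + b < 2 * T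
  · exact ⟨a, b, by omega, rfl, rfl⟩
  · by_cases h2 : a < T
    · exact ⟨a, w' - a, by omega, rfl, by omega⟩
    · by_cases h3 : b < T
      · exact ⟨w' - b, b, by omega, by omega, rfl⟩
      · exact ⟨T, w' - T, by omega, by omega, by omega⟩

theorem exists_splitting_of_min_eq {T e : ℕ} {w w' l : ℕ → ℕ}
    (h : ∀ j ∈ cubes e, min (w j) (2 * T) = min (w' j) (2 * T))
    (hl : ∀ j ∈ cubes e, w j = l (2 * j) + l (2 * j + 1)) :
    ∃ l' : ℕ → ℕ, (∀ j ∈ cubes e, w' j = l' (2 * j) + l' (2 * j + 1)) ∧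
      ∀ i ∈ cubes (e + 1), min (l i) T = min (l' i) T := by
  -- The equations for different cubes share no unknowns, so each cube is split on its own. The pair
  -- `(0, 0)` is a dummy outside `cubes e`.
  have key (j : ℕ) : ∃ p : ℕ × ℕ, j ∈ cubes e → w' j = p.1 + p.2 ∧
      min (l (2 * j)) T = min p.1 T ∧ min (l (2 * j + 1)) T = min p.2 T := by
    by_cases hj : j ∈ cubes e
    · obtain ⟨a', b', h'⟩ := exists_split_of_min_eq (hl j hj ▸ h j hj)
      exact ⟨(a', b'), fun _ => h'⟩
    · exact ⟨(0, 0), fun h => absurd h hj⟩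
  choose p hp using key
  refine ⟨fun i => if i % 2 = 0 then (p (i / 2)).1 else (p (i / 2)).2, fun j hj => ?_,
    forall_mem_cubes_succ.2 fun j hj => ⟨?_, ?_⟩⟩
  · have : (2 * j + 1) / 2 = j := by omega
    simpa [this] using (hp j hj).1
  · simpa using (hp j hj).2.1
  · have : (2 * j + 1) / 2 = j := by omega
    simpa [this] using (hp j hj).2.2

/-- Comparing two arbitrary valuations, rather than one with its capped version, makes the induction
go through: the splitting found by the back-and-forth step need not be capped. Capping itself is the
case `w' = min w (2 ^ t)`. -/
theorem Prenex.holds_stage_congr_of_min_eq {S N : ℕ} (P : Prenex 0 S) {t : ℕ} (ht : t ≤ S)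
    {w w' : ℕ → ℕ} (h : ∀ j ∈ cubes (S - t), min (w j) (2 ^ t) = min (w' j) (2 ^ t)) :
    (P.stage t).Holds N (fun j => (w j : ℤ)) ↔ (P.stage t).Holds N (fun j => (w' j : ℤ)) := by
  induction t generalizing w w' with
  | zero =>
    refine holds_translate_congr _ fun j hj => ?_
    have := h j hj
    omega
  | succ t ih =>
    rw [P.holds_stage_succ ht, P.holds_stage_succ ht]
    rw [show S - (t + 1) = S - 1 - t by omega, pow_succ'] at h
    have e : S - t = S - 1 - t + 1 := by omega
    refine Quant.sat_iff (fun l hl => ?_) (fun l hl => ?_)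
    · obtain ⟨l', hl', h'⟩ := exists_splitting_of_min_eq h hl
      exact ⟨l', hl', ih (by omega) (e ▸ h')⟩
    · obtain ⟨l', hl', h'⟩ := exists_splitting_of_min_eq (fun j hj => (h j hj).symm) hl
      exact ⟨l', hl', (ih (by omega) (e ▸ h')).symm⟩

/-! ### Substitution of the constant -/

theorem PATerm.eval_substMax {N x : ℕ} {v : ℕ → ℤ} (t : PATerm) :
    (t.substMax x).eval N v = t.eval N (Function.update v x N) := by
  induction t with
  | var y => by_cases h : y = x <;> simp [PATerm.substMax, PATerm.eval, h]
  | _ => simp_all [PATerm.substMax, PATerm.eval]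

theorem PAFormula.holds_substMax {N x : ℕ} {v : ℕ → ℤ} (F : PAFormula) :
    (F.substMax x).Holds N v ↔ F.Holds N (Function.update v x N) := by
  induction F generalizing v with
  | ex y F ih =>
    by_cases h : y = x
    · subst h
      simp [PAFormula.substMax, Holds]
    · simp [PAFormula.substMax, Holds, h, ih, Function.update_comm h]
  | all y F ih =>
    by_cases h : y = x
    · subst h
      simp [PAFormula.substMax, Holds]
    · simp [PAFormula.substMax, Holds, h, ih, Function.update_comm h]
  | _ => simp_all [PAFormula.substMax, Holds, PATerm.eval_substMax]

theorem trueAt_alpha {F : BAFormula 0} {N : ℕ} :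
    (alpha F).TrueAt N ↔ (F.prenex.stage F.numVars).Holds N fun _ => (N : ℤ) := by
  have h (v : ℕ → ℤ) : (alpha F).Holds N v ↔
      (F.prenex.stage F.numVars).Holds N fun _ => (N : ℤ) := by
    rw [alpha, PAFormula.holds_substMax]
    -- The last stage depends only on the variable 1, the sole member of `cubes 0`, so the constant
    -- valuation is as good as an update at 1.
    refine F.prenex.overCubes_stage le_rfl _ _ _ fun j hj => ?_
    have : j = 1 := by rw [mem_cubes] at hj; simp at hj; omega
    simp [this]
  simp [PAFormula.TrueAt, h]

/-- The constant occurs in none of the stages, so that it may be changed. -/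
theorem Prenex.holds_stage_maxcard {S : ℕ} (P : Prenex 0 S) {t : ℕ} (ht : t ≤ S) {N N' : ℕ}
    {w : ℕ → ℕ} : (P.stage t).Holds N (fun j => (w j : ℤ)) ↔
      (P.stage t).Holds N' (fun j => (w j : ℤ)) := by
  induction t generalizing w with
  | zero =>
    rw [Prenex.stage]
    generalize P.matrix.map (Fin.cast (Nat.zero_add S)) = Q
    induction Q with
    | eq a b => simp only [QFree.translate, Holds, holds_cardZero]
    | subset a b => simp only [QFree.translate, holds_cardZero]
    | and F G hF hG => exact and_congr hF hG
    | or F G hF hG => exact or_congr hF hG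
    | not F hF => exact not_congr hF
  | succ t ih =>
    rw [P.holds_stage_succ ht, P.holds_stage_succ ht]
    exact Quant.sat_congr (fun _ => Iff.rfl) fun l _ => ih (by omega)

/-- `N` enters both as the meaning of `maxcard` and as the value of the free variable. The first is
irrelevant to a stage, and the second may be capped. -/
theorem trueAt_alpha_min (F : BAFormula 0) (N : ℕ) :
    (alpha F).TrueAt N ↔ (alpha F).TrueAt (min N (2 ^ F.numVars)) := by
  rw [trueAt_alpha, trueAt_alpha,
    F.prenex.holds_stage_maxcard le_rfl (N := min N (2 ^ F.numVars)) (N' := N)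
      (w := fun _ => min N (2 ^ F.numVars))]
  exact F.prenex.holds_stage_congr_of_min_eq le_rfl (w := fun _ => N)
    (w' := fun _ => min N (2 ^ F.numVars)) (by simp)

end BAPA

/-! ### Semantics: `alpha F` at `N` expresses truth of `F` over an `N`-element universe. -/

namespace BAPA

/-! ### Interpretation by sets

The subsets of a universe `E` are given by their characteristic functions. -/

theorem SetTerm.contains_map {V W : Type} (f : V → W) (c : W → Bool) (a : SetTerm V) :
    (a.map f).contains c = a.contains fun x => c (f x) := by
  induction a <;> simp_all [SetTerm.map, SetTerm.contains]

section

variable {E : Type}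

/-- Truth of a quantifier-free formula when the set variables have the values `ρ`. -/
def QFree.Sat {V : Type} (ρ : V → E → Bool) : QFree V → Prop
  | eq a b => ∀ x, a.contains (ρ · x) = b.contains (ρ · x)
  | subset a b => ∀ x, a.contains (ρ · x) → b.contains (ρ · x)
  | and F G => F.Sat ρ ∧ G.Sat ρ
  | or F G => F.Sat ρ ∨ G.Sat ρ
  | not F => ¬ F.Sat ρ

theorem QFree.sat_map {V W : Type} (f : V → W) (ρ : W → E → Bool) (Q : QFree V) :
    (Q.map f).Sat ρ ↔ Q.Sat fun x => ρ (f x) := by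
  induction Q <;> simp_all [QFree.map, QFree.Sat, SetTerm.contains_map]

/-- Truth of a formula when the set variables have the values `ρ`. -/
def BAFormula.Sat : {m : ℕ} → BAFormula m → (ℕ → E → Bool) → Prop
  | _, eq a b, ρ => ∀ x, a.contains (fun i : Fin _ => ρ i x) = b.contains (fun i : Fin _ => ρ i x)
  | _, subset a b, ρ => ∀ x, a.contains (fun i : Fin _ => ρ i x) → b.contains (fun i : Fin _ => ρ i x)
  | _, and F G, ρ => F.Sat ρ ∧ G.Sat ρ
  | _, or F G, ρ => F.Sat ρ ∨ G.Sat ρ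
  | _, not F, ρ => ¬ F.Sat ρ
  | m, ex F, ρ => ∃ X : E → Bool, F.Sat (Function.update ρ m X)
  | m, all F, ρ => ∀ X : E → Bool, F.Sat (Function.update ρ m X)

/-- Quantification over the set variables `e, e + 1, …`, the first of them outermost. -/
def quantify : List Quant → ℕ → (ℕ → E → Bool) → ((ℕ → E → Bool) → Prop) → Prop
  | [], _, ρ, M => M ρ
  | q :: qs, e, ρ, M =>
      q.sat (fun _ : E → Bool => True) fun X => quantify qs (e + 1) (Function.update ρ e X) M

theorem quantify_append (qs qs' : List Quant) (e : ℕ) (ρ : ℕ → E → Bool)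
    (M : (ℕ → E → Bool) → Prop) :
    quantify (qs ++ qs') e ρ M ↔
      quantify qs e ρ fun τ => quantify qs' (e + qs.length) τ M := by
  induction qs generalizing e ρ with
  | nil => rfl
  | cons q qs ih =>
    refine Quant.sat_congr (fun _ => Iff.rfl) fun X _ => ?_
    rw [show qs.append qs' = qs ++ qs' from rfl, ih, List.length_cons,
      show e + 1 + qs.length = e + (qs.length + 1) by omega]

/-- Values from `e` on are overwritten by the block, so the outer valuations need to agree only
below `e`, and the matrices only on valuations that the block can produce. -/
theorem quantify_congr {qs : List Quant} {e : ℕ} {ρ ρ' : ℕ → E → Bool}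
    {M M' : (ℕ → E → Bool) → Prop} (h : ∀ i < e, ρ i = ρ' i)
    (hM : ∀ τ τ', (∀ i < e, τ i = ρ i) → (∀ i < e + qs.length, τ i = τ' i) → (M τ ↔ M' τ')) :
    quantify qs e ρ M ↔ quantify qs e ρ' M' := by
  induction qs generalizing e ρ ρ' with
  | nil => exact hM _ _ (fun _ _ => rfl) h
  | cons q qs ih =>
    refine Quant.sat_congr (fun _ => Iff.rfl) fun X _ => ih (fun i hi => ?_) fun τ τ' h1 h2 => ?_
    · rcases Nat.lt_succ_iff_lt_or_eq.1 hi with hi | rfl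
      · rw [Function.update_of_ne hi.ne, Function.update_of_ne hi.ne, h i hi]
      · simp
    · refine hM τ τ' (fun i hi => ?_) fun i hi => h2 i ?_
      · rw [h1 i (by omega), Function.update_of_ne hi.ne]
      · simp only [List.length_cons] at hi
        omega

/-- An injective renaming commutes with updates. Being a shift from `e` on, `f` keeps the bound
variables consecutive. -/
theorem quantify_rename {f : ℕ → ℕ} (hf : f.Injective) {qs : List Quant} {e : ℕ}
    (he : ∀ i, f (e + i) = f e + i) {ρ : ℕ → E → Bool} {M : (ℕ → E → Bool) → Prop} :
    quantify qs (f e) ρ (fun τ => M (τ ∘ f)) ↔ quantify qs e (ρ ∘ f) M := by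
  induction qs generalizing e ρ with
  | nil => rfl
  | cons q qs ih =>
    refine Quant.sat_congr (fun _ => Iff.rfl) fun X _ => ?_
    rw [← Function.update_comp_eq_of_injective _ hf, ← he 1, ih]
    intro i
    rw [he 1, add_assoc, he]
    omega

theorem quantify_dual (qs : List Quant) (e : ℕ) (ρ : ℕ → E → Bool)
    (M : (ℕ → E → Bool) → Prop) :
    quantify (qs.map Quant.dual) e ρ (fun τ => ¬ M τ) ↔ ¬ quantify qs e ρ M := by
  induction qs generalizing e ρ with
  | nil => rfl
  | cons q qs ih => cases q <;> simp [quantify, Quant.dual, Quant.sat, ih]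

/-- Valid even over an empty universe, since the quantifiers range over the nonempty type `E →
Bool`. -/
theorem quantify_const_and (qs : List Quant) (e : ℕ) (ρ : ℕ → E → Bool)
    (C : Prop) (M : (ℕ → E → Bool) → Prop) :
    quantify qs e ρ (fun τ => C ∧ M τ) ↔ C ∧ quantify qs e ρ M := by
  induction qs generalizing e ρ with
  | nil => rfl
  | cons q qs ih => cases q <;> simp [quantify, Quant.sat, ih, forall_and]

theorem quantify_const_or (qs : List Quant) (e : ℕ) (ρ : ℕ → E → Bool)
    (C : Prop) (M : (ℕ → E → Bool) → Prop) :
    quantify qs e ρ (fun τ => C ∨ M τ) ↔ C ∨ quantify qs e ρ M := by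
  induction qs generalizing e ρ with
  | nil => rfl
  | cons q qs ih => cases q <;> simp [quantify, Quant.sat, ih, exists_or, forall_or_left]

/-- Truth of a prenex formula when the set variables have the values `ρ`. -/
def Prenex.Sat {m p : ℕ} (P : Prenex m p) (ρ : ℕ → E → Bool) : Prop :=
  quantify (List.ofFn P.quant) m ρ fun τ => P.matrix.Sat fun i : Fin _ => τ i

/-- In the inner block the matrix of `P` is constant and comes out; what remains is the truth of
`P'`, which is constant for the outer block. The abstract `op` covers conjunction and disjunction at
once. -/
theorem Prenex.sat_combine {m p q : ℕ} (P : Prenex m p) (P' : Prenex m q)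
    {op : Prop → Prop → Prop} (hcomm : ∀ A B, op A B ↔ op B A)
    (hconst : ∀ (qs : List Quant) (e : ℕ) (ρ : ℕ → E → Bool) (C : Prop)
      (M : (ℕ → E → Bool) → Prop), quantify qs e ρ (fun τ => op C (M τ)) ↔ op C (quantify qs e ρ M))
    (ρ : ℕ → E → Bool) :
    (quantify (List.ofFn (Fin.append P.quant P'.quant)) m ρ fun τ =>
      op ((P.matrix.map (leftVar m p q)).Sat fun i : Fin _ => τ i)
        ((P'.matrix.map (rightVar m p q)).Sat fun i : Fin _ => τ i)) ↔ op (P.Sat ρ) (P'.Sat ρ) := by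
  -- The renaming leaves a gap of `p` places after the first `m` variables, for the quantifiers of
  -- `P`; on numbers it is `rightVar`.
  let f : ℕ → ℕ := fun i => if i < m then i else i + p
  have hf : f.Injective := by
    intro i j h
    simp only [f] at h
    split_ifs at h <;> omega
  have hfm : f m = m + p := by simp [f]
  have hright (τ : ℕ → E → Bool) (i : Fin (m + q)) :
      τ (rightVar m p q i) = (τ ∘ f) i := by
    induction i using Fin.addCases with
    | left i => simp [rightVar, f]
    | right i => simp [rightVar, f]; congr 1; omega
  have hP' (τ : ℕ → E → Bool) (h : ∀ i < m, ρ i = τ i) :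
      (quantify (List.ofFn P'.quant) (m + p) τ fun σ =>
        P'.matrix.Sat fun i => σ (rightVar m p q i)) ↔ P'.Sat ρ := by
    simp only [hright]
    rw [← hfm, quantify_rename (M := fun σ => P'.matrix.Sat fun i : Fin _ => σ i) hf
      (fun i => by simp [f]; omega)]
    refine (quantify_congr (fun i hi => ?_) fun σ σ' _ h2 => ?_).symm
    · simp [f, hi, h i hi]
    · rw [List.length_ofFn] at h2
      simp only [h2 _ (Fin.is_lt _)]
  simp only [QFree.sat_map]
  rw [List.ofFn_fin_append, quantify_append, List.length_ofFn]
  have hinner (τ : ℕ → E → Bool) (h : ∀ i < m, ρ i = τ i) :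
      (quantify (List.ofFn P'.quant) (m + p) τ fun σ =>
        op (P.matrix.Sat fun i => σ (leftVar m p q i))
          (P'.matrix.Sat fun i => σ (rightVar m p q i))) ↔
      op (P'.Sat ρ) (P.matrix.Sat fun i : Fin _ => τ i) := by
    rw [hcomm, ← propext (hP' τ h), ← hconst]
    refine quantify_congr (fun _ _ => rfl) fun σ σ' h1 h2 => ?_
    have h3 (i : Fin (m + p)) : σ' (leftVar m p q i) = τ i := by
      rw [← h2 _ (by simp [leftVar]; omega)]
      exact h1 i i.2
    have h4 (i : Fin (m + q)) : σ (rightVar m p q i) = σ' (rightVar m p q i) :=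
      h2 _ (by have := (rightVar m p q i).2; simp only [List.length_ofFn]; omega)
    have h5 (i : Fin (m + p)) : σ (leftVar m p q i) = τ i := h1 i i.2
    simp only [h4, h5]
  rw [hcomm]
  refine Iff.trans ?_ (hconst (List.ofFn P.quant) m ρ (P'.Sat ρ) fun τ =>
    P.matrix.Sat fun i : Fin _ => τ i)
  exact quantify_congr (fun _ _ => rfl) fun τ τ' h1 h2 => by
    rw [hinner τ fun i hi => (h1 i hi).symm]
    rw [List.length_ofFn] at h2
    simp only [h2 _ (Fin.is_lt _)]

theorem Prenex.sat_cons {m p : ℕ} (q : Quant) (P : Prenex (m + 1) p) (ρ : ℕ → E → Bool) :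
    (quantify (List.ofFn (Fin.cons q P.quant : Fin (p + 1) → Quant)) m ρ fun τ =>
      (P.matrix.map (Fin.cast (Nat.add_right_comm m 1 p))).Sat fun i : Fin _ => τ i) ↔
      q.sat (fun _ => True) fun X => P.Sat (Function.update ρ m X) := by
  simp only [List.ofFn_succ, Fin.cons_zero, Fin.cons_succ, quantify, QFree.sat_map, Fin.val_cast,
    Prenex.Sat]

theorem BAFormula.sat_prenex {m : ℕ} (F : BAFormula m) (ρ : ℕ → E → Bool) :
    F.prenex.Sat ρ ↔ F.Sat ρ := by
  induction F generalizing ρ with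
  | eq a b => rfl
  | subset a b => rfl
  | and F G hF hG =>
    rw [BAFormula.Sat, ← hF, ← hG]
    exact Prenex.sat_combine (op := And) _ _ (fun _ _ => and_comm) quantify_const_and ρ
  | or F G hF hG =>
    rw [BAFormula.Sat, ← hF, ← hG]
    exact Prenex.sat_combine (op := Or) _ _ (fun _ _ => or_comm) quantify_const_or ρ
  | not F hF =>
    rw [BAFormula.Sat, ← hF, Prenex.Sat, Prenex.Sat, ← quantify_dual, List.map_ofFn]
    rfl
  | ex F hF =>
    simp only [BAFormula.Sat, ← hF]
    exact (Prenex.sat_cons .ex F.prenex ρ).trans (by simp [Quant.sat])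
  | all F hF =>
    simp only [BAFormula.Sat, ← hF]
    exact (Prenex.sat_cons .all F.prenex ρ).trans (by simp [Quant.sat])

/-! ### Stages and sets -/

/-- The number of the cube of the first `e` set variables in which the element `x` lies. -/
def cubeOf (ρ : ℕ → E → Bool) : ℕ → E → ℕ
  | 0, _ => 1
  | e + 1, x => Nat.bit (ρ e x) (cubeOf ρ e x)

theorem cubeOf_congr {ρ ρ' : ℕ → E → Bool} {e : ℕ} (h : ∀ i < e, ρ i = ρ' i) (x : E) :
    cubeOf ρ e x = cubeOf ρ' e x := by
  induction e with
  | zero => rfl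
  | succ e ih => rw [cubeOf, cubeOf, h e (by omega), ih fun i hi => h i (by omega)]

theorem cubeOf_mem_cubes (ρ : ℕ → E → Bool) (e : ℕ) (x : E) : cubeOf ρ e x ∈ cubes e := by
  induction e with
  | zero => simp [cubeOf, mem_cubes]
  | succ e ih =>
    rw [cubeOf]
    cases ρ e x
    · exact two_mul_mem_cubes.2 ih
    · exact two_mul_add_one_mem_cubes.2 ih

/-- Each new variable is appended as the lowest bit, so variable `i` ends up in position `e - 1 -
i`, as `cubeIn` expects. -/
theorem testBit_cubeOf (ρ : ℕ → E → Bool) {e i : ℕ} (h : i < e) (x : E) :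
    (cubeOf ρ e x).testBit (e - 1 - i) = ρ i x := by
  induction e with
  | zero => omega
  | succ e ih =>
    rw [cubeOf]
    rcases Nat.lt_succ_iff_lt_or_eq.1 h with h | rfl
    · rw [show e + 1 - 1 - i = e - 1 - i + 1 by omega, Nat.testBit_bit_succ, ih h]
    · simp

variable [Fintype E]

/-- The cardinalities of the cubes of the first `e` set variables. -/
def cubeCard (ρ : ℕ → E → Bool) (e j : ℕ) : ℕ :=
  (Finset.univ.filter fun x => cubeOf ρ e x = j).card

theorem cubeCard_eq_zero {ρ : ℕ → E → Bool} {e j : ℕ} :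
    cubeCard ρ e j = 0 ↔ ∀ x, cubeOf ρ e x ≠ j := by
  simp [cubeCard, Finset.filter_eq_empty_iff]

theorem cubeCard_update_even (ρ : ℕ → E → Bool) (e j : ℕ) (X : E → Bool) :
    cubeCard (Function.update ρ e X) (e + 1) (2 * j) =
      (Finset.univ.filter fun x => cubeOf ρ e x = j ∧ X x = false).card := by
  rw [cubeCard]
  congr 1
  ext x
  have := cubeOf_congr (e := e) (ρ := Function.update ρ e X) (ρ' := ρ)
    (fun i hi => Function.update_of_ne hi.ne _ _) x
  cases h : X x <;> simp [cubeOf, this, h, Nat.bit_val] ; omega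

theorem cubeCard_update_odd (ρ : ℕ → E → Bool) (e j : ℕ) (X : E → Bool) :
    cubeCard (Function.update ρ e X) (e + 1) (2 * j + 1) =
      (Finset.univ.filter fun x => cubeOf ρ e x = j ∧ X x = true).card := by
  rw [cubeCard]
  congr 1
  ext x
  have := cubeOf_congr (e := e) (ρ := Function.update ρ e X) (ρ' := ρ)
    (fun i hi => Function.update_of_ne hi.ne _ _) x
  cases h : X x <;> simp [cubeOf, this, h, Nat.bit_val] ; omega

theorem cubeCard_split (ρ : ℕ → E → Bool) (e j : ℕ) (X : E → Bool) :
    cubeCard ρ e j = cubeCard (Function.update ρ e X) (e + 1) (2 * j) +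
      cubeCard (Function.update ρ e X) (e + 1) (2 * j + 1) := by
  rw [cubeCard_update_even, cubeCard_update_odd, cubeCard,
    ← Finset.card_filter_add_card_filter_not (fun x => X x = false)]
  simp [Finset.filter_filter]

/-- Inside each cube choose a subset of the prescribed size. The cubes are disjoint, so the union of
these subsets meets each cube in the right number of elements; membership of `x` is decided in the
cube of `x`. -/
theorem exists_set_of_split {ρ : ℕ → E → Bool} {e : ℕ} {l : ℕ → ℕ}
    (hl : ∀ j ∈ cubes e, cubeCard ρ e j = l (2 * j) + l (2 * j + 1)) :
    ∃ X : E → Bool, ∀ i ∈ cubes (e + 1), l i = cubeCard (Function.update ρ e X) (e + 1) i := by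
  classical
  have key (j : ℕ) : ∃ s : Finset E, j ∈ cubes e →
      s ⊆ (Finset.univ.filter fun x => cubeOf ρ e x = j) ∧ s.card = l (2 * j + 1) := by
    by_cases hj : j ∈ cubes e
    · obtain ⟨s, h⟩ := Finset.exists_subset_card_eq
        (show l (2 * j + 1) ≤ (Finset.univ.filter fun x => cubeOf ρ e x = j).card by
          have := hl j hj
          rw [cubeCard] at this
          omega)
      exact ⟨s, fun _ => h⟩
    · exact ⟨∅, fun h => absurd h hj⟩
  choose s hs using key
  refine ⟨fun x => decide (x ∈ s (cubeOf ρ e x)), forall_mem_cubes_succ.2 fun j hj => ?_⟩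
  have h2 : l (2 * j + 1) =
      cubeCard (Function.update ρ e fun x => decide (x ∈ s (cubeOf ρ e x))) (e + 1) (2 * j + 1) := by
    rw [cubeCard_update_odd, ← (hs j hj).2]
    congr 1
    ext x
    have := @(hs j hj).1 x
    simp only [Finset.mem_filter, Finset.mem_univ, true_and, decide_eq_true_eq] at this ⊢
    constructor
    · intro h
      exact ⟨this h, (this h).symm ▸ h⟩
    · rintro ⟨rfl, h⟩
      exact h
  refine ⟨?_, h2⟩
  have h1 := cubeCard_split ρ e j fun x => decide (x ∈ s (cubeOf ρ e x))
  rw [← h2, hl j hj] at h1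
  omega

theorem holds_cardZero_cubeCard {S N : ℕ} (b : SetTerm (Fin S)) (ρ : ℕ → E → Bool) :
    (cardZero b).Holds N (fun j => (cubeCard ρ S j : ℤ)) ↔
      ∀ x, b.contains (fun i : Fin _ => ρ i x) = false := by
  have hc (x : E) : cubeIn S (cubeOf ρ S x) = fun i : Fin S => ρ i x := by
    funext i
    exact testBit_cubeOf ρ i.2 x
  rw [holds_cardZero]
  simp only [cubeCard_eq_zero]
  constructor
  · intro h x
    by_contra hx
    rw [Bool.not_eq_false, ← hc] at hx
    exact h _ (cubeOf_mem_cubes ρ S x) hx x rfl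
  · rintro h j - hj x rfl
    rw [hc, h x] at hj
    exact Bool.false_ne_true hj

theorem holds_translate_cubeCard {S N : ℕ} (Q : QFree (Fin S)) (ρ : ℕ → E → Bool) :
    Q.translate.Holds N (fun j => (cubeCard ρ S j : ℤ)) ↔ Q.Sat fun i : Fin _ => ρ i := by
  induction Q with
  | eq a b =>
    simp only [QFree.translate, PAFormula.Holds, holds_cardZero_cubeCard, QFree.Sat,
      SetTerm.contains, ← forall_and]
    refine forall_congr' fun x => ?_
    cases a.contains fun i : Fin _ => ρ i x <;> cases b.contains fun i : Fin _ => ρ i x <;> simp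
  | subset a b =>
    simp only [QFree.translate, holds_cardZero_cubeCard, QFree.Sat, SetTerm.contains]
    refine forall_congr' fun x => ?_
    cases a.contains fun i : Fin _ => ρ i x <;> cases b.contains fun i : Fin _ => ρ i x <;> simp
  | and F G hF hG => exact and_congr hF hG
  | or F G hF hG => exact or_congr hF hG
  | not F hF => exact not_congr hF

/-- Each set splits the cubes, and each splitting of the cardinalities comes from a set; so
eliminating a quantifier over sets preserves truth. -/
theorem Prenex.holds_stage_cubeCard {S N : ℕ} (P : Prenex 0 S) {t : ℕ} (ht : t ≤ S)
    (ρ : ℕ → E → Bool) :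
    (P.stage t).Holds N (fun j => (cubeCard ρ (S - t) j : ℤ)) ↔
      quantify ((List.ofFn P.quant).drop (S - t)) (S - t) ρ
        fun τ => P.matrix.Sat fun i : Fin _ => τ i := by
  induction t generalizing ρ with
  | zero =>
    rw [Nat.sub_zero, List.drop_eq_nil_of_le (by simp), Prenex.stage, holds_translate_cubeCard,
      QFree.sat_map]
    rfl
  | succ t ih =>
    have e : S - t = S - 1 - t + 1 := by omega
    rw [P.holds_stage_succ ht, show S - (t + 1) = S - 1 - t by omega,
      List.drop_eq_getElem_cons (by simp; omega), List.getElem_ofFn]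
    refine Quant.sat_iff (fun l hl => ?_) (fun X _ => ?_)
    · obtain ⟨X, hX⟩ := exists_set_of_split hl
      refine ⟨X, trivial, ?_⟩
      rw [← e, ← ih (by omega)]
      exact P.overCubes_stage (by omega) _ _ _ fun j hj => by rw [e] at hj ⊢; rw [hX j hj]
    · refine ⟨_, fun j _ => cubeCard_split ρ _ j X, ?_⟩
      rw [← e, ← ih (by omega)]

/-- This lets the machines work with sets and ignore Presburger arithmetic. The valuation `ρ` is
arbitrary because `F` is a sentence. -/
theorem trueAt_alpha_iff_sat (F : BAFormula 0) (ρ : ℕ → E → Bool) :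
    (alpha F).TrueAt (Fintype.card E) ↔ F.Sat ρ := by
  have h := F.prenex.holds_stage_cubeCard (N := Fintype.card E) le_rfl ρ
  rw [Nat.sub_self, List.drop_zero] at h
  rw [trueAt_alpha, ← F.sat_prenex]
  refine Iff.trans ?_ h
  refine F.prenex.overCubes_stage le_rfl _ _ _ fun j hj => ?_
  have : j = 1 := by rw [mem_cubes] at hj; simp at hj; omega
  simp [this, cubeCard, cubeOf]

end

end BAPA

/-! ### A structured stack language with space accounting, and its compilation to Turing machines.
-/

namespace BAPA

/-! ### Structured stack programs -/

instance : Finite Sym := by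
  let f : Sym → Fin 14 × Bool
    | .var => (0, false) | .tick => (1, false) | .empty => (2, false) | .univ => (3, false)
    | .union => (4, false) | .inter => (5, false) | .compl => (6, false) | .eq => (7, false)
    | .subset => (8, false) | .and => (9, false) | .or => (10, false) | .not => (11, false)
    | .ex => (12, false) | .all => (12, true) | .bit b => (13, b)
  refine Finite.of_injective f fun a b h => ?_
  cases a <;> cases b <;> simp_all [f]

/-- Names of the stacks. -/
inductive Stk : Type
  | inp | lft | rgt | col | don | tmp | ctl | val
  deriving DecidableEq

instance : Fintype Stk where
  elems := ⟨([.inp, .lft, .rgt, .col, .don, .tmp, .ctl, .val] : List Stk), by decide⟩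
  complete k := by cases k <;> decide

/-- Contents of the stacks. -/
structure State : Type where
  (inp lft rgt col don tmp ctl val : List Sym)

namespace State

def get (s : State) : Stk → List Sym
  | .inp => s.inp
  | .lft => s.lft
  | .rgt => s.rgt
  | .col => s.col
  | .don => s.don
  | .tmp => s.tmp
  | .ctl => s.ctl
  | .val => s.val

def set (s : State) (k : Stk) (x : List Sym) : State :=
  match k with
  | .inp => { s with inp := x }
  | .lft => { s with lft := x }
  | .rgt => { s with rgt := x }
  | .col => { s with col := x }
  | .don => { s with don := x }
  | .tmp => { s with tmp := x }
  | .ctl => { s with ctl := x }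
  | .val => { s with val := x }

/-- The number of occupied cells. -/
def size (s : State) : ℕ :=
  s.inp.length + s.lft.length + s.rgt.length + s.col.length + s.don.length + s.tmp.length +
    s.ctl.length + s.val.length

theorem size_eq_sum (s : State) : s.size = ∑ k, (s.get k).length := by
  change _ = s.inp.length + (s.lft.length + (s.rgt.length + (s.col.length + (s.don.length +
    (s.tmp.length + (s.ctl.length + (s.val.length + 0)))))))
  rw [size]
  omega

theorem get_set (s : State) (k k' : Stk) (x : List Sym) :
    (s.set k x).get k' = Function.update s.get k x k' := by
  cases k <;> cases k' <;> rfl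

theorem size_set_tail_le (s : State) (k : Stk) : (s.set k (s.get k).tail).size ≤ s.size := by
  rw [size_eq_sum, size_eq_sum]
  refine Finset.sum_le_sum fun k' _ => ?_
  rw [get_set]
  by_cases h : k' = k
  · subst h
    simp
  · rw [Function.update_of_ne h]

end State

/-- Programs. A case distinction and the condition of a loop depend on the top of a stack. -/
inductive Cmd : Type
  | skip
  | push (k : Stk) (a : Sym)
  | pop (k : Stk)
  | seq (c d : Cmd)
  | case (k : Stk) (f : Option Sym → Cmd)
  | loop (k : Stk) (p : Option Sym → Bool) (c : Cmd)

/-- Terminating execution of a program, with at most `B` cells occupied. -/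
inductive Run (B : ℕ) : Cmd → State → State → Prop
  | skip (s : State) : Run B .skip s s
  | push {s : State} {k : Stk} {a : Sym} (h : (s.set k (a :: s.get k)).size ≤ B) :
      Run B (.push k a) s (s.set k (a :: s.get k))
  | pop (s : State) (k : Stk) : Run B (.pop k) s (s.set k (s.get k).tail)
  | seq {c d : Cmd} {s t u : State} (h : Run B c s t) (h' : Run B d t u) : Run B (.seq c d) s u
  | case {k : Stk} {f : Option Sym → Cmd} {s t : State} (h : Run B (f (s.get k).head?) s t) :
      Run B (.case k f) s t
  | loopEnd {k : Stk} {p : Option Sym → Bool} {c : Cmd} {s : State}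
      (hp : p (s.get k).head? = false) : Run B (.loop k p c) s s
  | step {k : Stk} {p : Option Sym → Bool} {c : Cmd} {s t u : State}
      (hp : p (s.get k).head? = true) (h : Run B c s t) (h' : Run B (.loop k p c) t u) :
      Run B (.loop k p c) s u

/-! ### Compilation -/

open Turing

/-- The labels of a program. -/
def Cmd.Label : Cmd → Type
  | skip => Unit
  | push _ _ => Unit
  | pop _ => Unit
  | seq c d => c.Label ⊕ d.Label
  | case _ f => Option (Σ a, (f a).Label)
  | loop _ _ c => Option c.Label

instance Cmd.finite_label : (c : Cmd) → Finite c.Label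
  | skip => inferInstanceAs (Finite Unit)
  | push _ _ => inferInstanceAs (Finite Unit)
  | pop _ => inferInstanceAs (Finite Unit)
  | seq c d =>
      have := c.finite_label
      have := d.finite_label
      inferInstanceAs (Finite (c.Label ⊕ d.Label))
  | case _ f =>
      have := fun a => (f a).finite_label
      inferInstanceAs (Finite (Option (Σ a, (f a).Label)))
  | loop _ _ c =>
      have := c.finite_label
      inferInstanceAs (Finite (Option c.Label))

def Cmd.entry : (c : Cmd) → c.Label
  | skip => ()
  | push _ _ => ()
  | pop _ => ()
  | seq c _ => .inl c.entry
  | case _ _ => none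
  | loop _ _ _ => none

/-- Stack alphabets: there is one additional stack, for the answer. -/
abbrev Alphabet : Option Stk → Type
  | none => Bool
  | some _ => Sym

/-- The statements of a program whose labels are embedded by `e` and which continues
at `next`. -/
def Cmd.code {Λ : Type} : (c : Cmd) → (c.Label → Λ) → Λ → c.Label →
    TM2.Stmt Alphabet Λ (Option Sym)
  | skip, _, next, _ => .goto fun _ => next
  | push k a, _, next, _ => .push (some k) (fun _ => a) (.goto fun _ => next)
  | pop k, _, next, _ => .pop (some k) (fun v _ => v) (.goto fun _ => next)
  | seq c d, e, next, l =>
      match l with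
      | .inl l => c.code (fun l => e (.inl l)) (e (.inr d.entry)) l
      | .inr l => d.code (fun l => e (.inr l)) next l
  | case k f, e, next, l =>
      match l with
      | none => .peek (some k) (fun _ a => a) (.goto fun v => e (some ⟨v, (f v).entry⟩))
      | some ⟨a, l⟩ => (f a).code (fun l => e (some ⟨a, l⟩)) next l
  | loop k p c, e, next, l =>
      match l with
      | none => .peek (some k) (fun _ a => a)
          (.goto fun v => if p v then e (some c.entry) else next)
      | some l => c.code (fun l => e (some l)) (e none) l

/-- Stack contents of the machine. -/
def State.contents (s : State) : ∀ k, List (Alphabet k)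
  | none => []
  | some k => s.get k

theorem State.update_contents (s : State) (k : Stk) (x : List Sym) :
    Function.update s.contents (some k) x = (s.set k x).contents := by
  funext k'
  cases k' with
  | none => rfl
  | some k' =>
    by_cases h : k' = k
    · subst h
      simp [contents, get_set]
    · rw [Function.update_of_ne (by simpa using h)]
      simp [contents, get_set, h]

section

variable {Λ : Type}

/-- The number of occupied cells. -/
def cfgCells (c : TM2.Cfg Alphabet Λ (Option Sym)) : ℕ := ∑ k, (c.stk k).length

theorem cfgCells_contents (l : Option Λ) (v : Option Sym) (s : State) :
    cfgCells ⟨l, v, s.contents⟩ = s.size := by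
  rw [cfgCells, Fintype.sum_option, State.size_eq_sum]
  simp [State.contents]

/-- A part of a run, with at most `B` cells occupied after each step. -/
inductive Path (m : Λ → TM2.Stmt Alphabet Λ (Option Sym)) (B : ℕ) :
    TM2.Cfg Alphabet Λ (Option Sym) → TM2.Cfg Alphabet Λ (Option Sym) → Prop
  | refl (c) : Path m B c c
  | head {c c' d} (h : TM2.step m c = some c') (hB : cfgCells c' ≤ B) (h' : Path m B c' d) :
      Path m B c d

theorem Path.trans {m : Λ → TM2.Stmt Alphabet Λ (Option Sym)} {B : ℕ}
    {c d e : TM2.Cfg Alphabet Λ (Option Sym)} (h : Path m B c d) (h' : Path m B d e) :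
    Path m B c e := by
  induction h with
  | refl => exact h'
  | head h hB _ ih => exact .head h hB (ih h')

theorem Path.reaches {m : Λ → TM2.Stmt Alphabet Λ (Option Sym)} {B : ℕ}
    {c d : TM2.Cfg Alphabet Λ (Option Sym)} (h : Path m B c d) :
    StateTransition.Reaches (TM2.step m) c d := by
  induction h with
  | refl => exact .refl
  | head h _ _ ih => exact .head h ih

/-- The step function is deterministic and the path ends in a halted configuration, so everything
reachable lies on the path. -/
theorem Path.cells_le {m : Λ → TM2.Stmt Alphabet Λ (Option Sym)} {B : ℕ}
    {c d e : TM2.Cfg Alphabet Λ (Option Sym)} (h : Path m B c d) (hd : TM2.step m d = none)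
    (hc : cfgCells c ≤ B) (he : StateTransition.Reaches (TM2.step m) c e) : cfgCells e ≤ B := by
  induction h with
  | refl c =>
    rcases Relation.ReflTransGen.cases_head he with rfl | ⟨x, hx, -⟩
    · exact hc
    · rw [Option.mem_def, hd] at hx
      cases hx
  | head h hB _ ih =>
    rcases Relation.ReflTransGen.cases_head he with rfl | ⟨x, hx, hxe⟩
    · exact hc
    · rw [Option.mem_def, h] at hx
      cases hx
      exact ih hd hB hxe

end

theorem Run.size_le {B : ℕ} {c : Cmd} {s t : State} (h : Run B c s t) (hs : s.size ≤ B) :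
    t.size ≤ B := by
  induction h with
  | skip => exact hs
  | push h => exact h
  | pop s k => exact (s.size_set_tail_le k).trans hs
  | seq _ _ ih ih' => exact ih' (ih hs)
  | case _ ih => exact ih hs
  | loopEnd => exact hs
  | step _ _ _ ih ih' => exact ih' (ih hs)

/-- Induction on the execution. The hypothesis `hm` says that the machine contains the code of `c`
at the labels `e`, so it passes to subprograms by composing embeddings. The internal state `v` is
scratch: every `peek` overwrites it before it is used. -/
theorem Run.path {Λ : Type} {m : Λ → TM2.Stmt Alphabet Λ (Option Sym)} {B : ℕ} {c : Cmd}
    {s t : State} (h : Run B c s t) (hs : s.size ≤ B) (e : c.Label → Λ) (next : Λ)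
    (hm : ∀ l, m (e l) = c.code e next l) (v : Option Sym) :
    ∃ v', Path m B ⟨some (e c.entry), v, s.contents⟩ ⟨some next, v', t.contents⟩ := by
  induction h generalizing next v with
  | skip s =>
    refine ⟨v, .head (c' := ⟨some next, v, s.contents⟩) ?_ ?_ (.refl _)⟩
    · rw [TM2.step, hm]
      rfl
    · rwa [cfgCells_contents]
  | @push s k a h =>
    refine ⟨v, .head (c' := ⟨some next, v, (s.set k (a :: s.get k)).contents⟩) ?_ ?_ (.refl _)⟩
    · rw [TM2.step, hm, ← State.update_contents]
      rfl
    · rwa [cfgCells_contents]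
  | pop s k =>
    refine ⟨v, .head (c' := ⟨some next, v, (s.set k (s.get k).tail).contents⟩) ?_ ?_ (.refl _)⟩
    · rw [TM2.step, hm, ← State.update_contents]
      rfl
    · rw [cfgCells_contents]
      exact (s.size_set_tail_le k).trans hs
  | @seq c d s t u h h' ih ih' =>
    obtain ⟨v₁, h₁⟩ := ih hs (fun l => e (.inl l)) (e (.inr d.entry)) (fun l => hm (.inl l)) v
    obtain ⟨v₂, h₂⟩ := ih' (h.size_le hs) (fun l => e (.inr l)) next (fun l => hm (.inr l)) v₁
    exact ⟨v₂, h₁.trans h₂⟩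
  | @case k f s t h ih =>
    obtain ⟨v₁, h₁⟩ := ih hs (fun l => e (some ⟨_, l⟩)) next (fun l => hm (some ⟨_, l⟩))
      (s.get k).head?
    refine ⟨v₁, .head ?_ ?_ h₁⟩
    · rw [TM2.step, hm]
      rfl
    · rwa [cfgCells_contents]
  | @loopEnd k p c s hp =>
    refine ⟨(s.get k).head?, .head (c' := ⟨some next, (s.get k).head?, s.contents⟩) ?_ ?_ (.refl _)⟩
    · rw [TM2.step, hm]
      change some (TM2.Cfg.mk (some (if p (s.get k).head? = true then _ else _)) _ _) = _
      rw [hp]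
      rfl
    · rwa [cfgCells_contents]
  | @step k p c s t u hp h h' ih ih' =>
    obtain ⟨v₁, h₁⟩ := ih hs (fun l => e (some l)) (e none) (fun l => hm (some l))
      (s.get k).head?
    obtain ⟨v₂, h₂⟩ := ih' (h.size_le hs) e next hm v₁
    refine ⟨v₂, .head ?_ ?_ (h₁.trans h₂)⟩
    · rw [TM2.step, hm]
      change some (TM2.Cfg.mk (some (if p (s.get k).head? = true then _ else _)) _ _) = _
      rw [hp]
      rfl
    · rwa [cfgCells_contents]

/-- The machine that executes a program on the input and answers with the bit which is left on
the stack `val`. -/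
noncomputable def Cmd.machine (c : Cmd) : Machine where
  tm :=
    { K := Option Stk
      k₀ := some .inp
      k₁ := none
      Γ := Alphabet
      Λ := Option c.Label
      main := some c.entry
      ΛFin := Fintype.ofFinite _
      σ := Option Sym
      initialState := none
      σFin := Fintype.ofFinite _
      Γk₀Fin := @Fintype.ofFinite Sym _
      m := fun l =>
        match l with
        | some l => c.code some none l
        | none => .pop (some .val) (fun _ a => a) (.push none
            (fun v => match v with
              | some (.bit b) => b
              | _ => false)
            (.load (fun _ => none) .halt)) }
  inputAlphabet := Equiv.refl Sym
  outputAlphabet := Equiv.refl Bool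

theorem Cmd.finiteAlphabets_machine (c : Cmd) : c.machine.FiniteAlphabets := fun k =>
  match k with
  | none => inferInstanceAs (Finite Bool)
  | some _ => inferInstanceAs (Finite Sym)

/-- The state with `x` on the input stack and `y` on the stack `val`, all others being empty. -/
def State.ofInp (x y : List Sym) : State := ⟨x, [], [], [], [], [], [], y⟩

theorem Cmd.machine_init (c : Cmd) (x : List Sym) :
    c.machine.init x = ⟨some (some c.entry), none, (State.ofInp x []).contents⟩ := by
  rw [Machine.init, initList]
  congr 1
  funext k
  rcases k with _ | k
  · rfl
  · cases k
    case inp => exact List.map_id x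
    all_goals rfl

theorem Cmd.haltList_machine (c : Cmd) (b : Bool) :
    haltList c.machine.tm ([b].map c.machine.outputAlphabet.symm) =
      ⟨none, none, Function.update (State.ofInp [] []).contents none [b]⟩ := by
  rw [haltList]
  congr 1
  funext k
  rcases k with _ | k
  · rfl
  · cases k <;> rfl

theorem nonempty_evalsTo_of_reaches {α : Type} {f : α → Option α} {a b : α}
    (h : StateTransition.Reaches f a b) : Nonempty (StateTransition.EvalsTo f a (some b)) := by
  induction h using Relation.ReflTransGen.head_induction_on with
  | refl => exact ⟨.refl _ _⟩
  | head h _ ih =>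
    obtain ⟨n, hn⟩ := ih
    exact ⟨⟨n + 1, by rw [Function.iterate_succ_apply]; simpa [flip, Option.mem_def.1 h] using hn⟩⟩

theorem Cmd.machine_spec {c : Cmd} {x : List Sym} {b : Bool} {B : ℕ}
    (h : Run B c (State.ofInp x []) (State.ofInp [] [.bit b])) (hx : x.length ≤ B) :
    c.machine.Answers x b ∧ c.machine.RunsInSpace x B := by
  have hs : (State.ofInp x []).size ≤ B := by simpa [State.size, State.ofInp] using hx
  obtain ⟨v, hp⟩ := h.path (m := c.machine.tm.m) hs some none (fun _ => rfl) none
  -- The final state holds one symbol, so there is room for the single cell of the answer.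
  have hB : 1 ≤ B := by simpa [State.size, State.ofInp] using h.size_le hs
  have hlast : Path c.machine.tm.m B ⟨some none, v, (State.ofInp [] [.bit b]).contents⟩
      ⟨none, none, Function.update (State.ofInp [] []).contents none [b]⟩ := by
    refine .head ?_ ?_ (.refl _)
    · change some (TM2.Cfg.mk none none _) = _
      congr 2
      funext k
      rcases k with _ | k
      · rfl
      · cases k <;> rfl
    · rw [cfgCells, Fintype.sum_option, Finset.sum_eq_zero]
      · simpa using hB
      · intro k _
        cases k <;> rfl
  have hpath := hp.trans hlast
  constructor
  · rw [Machine.Answers, TM2Outputs, Option.map_some, c.haltList_machine]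
    have := c.machine_init x
    rw [Machine.init] at this
    rw [this]
    exact nonempty_evalsTo_of_reaches hpath.reaches
  · intro d hd
    rw [c.machine_init] at hd
    have := hpath.cells_le rfl ((cfgCells_contents _ _ _).trans_le hs) hd
    unfold cfgCells at this
    unfold Machine.cells
    exact this

end BAPA

/-! ### Weakest preconditions, and programs acting on columns of bits. -/

namespace BAPA

/-! ### Weakest preconditions -/

/-- The program terminates from `s` in a state satisfying `Q`, at most `B` cells being occupied. -/
def WP (B : ℕ) (c : Cmd) (Q : State → Prop) (s : State) : Prop := ∃ t, Run B c s t ∧ Q t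

variable {B : ℕ} {Q : State → Prop} {s : State}

theorem wp_skip : WP B .skip Q s ↔ Q s :=
  ⟨fun ⟨_, h, hQ⟩ => by cases h; exact hQ, fun h => ⟨s, .skip s, h⟩⟩

theorem wp_push {k : Stk} {a : Sym} : WP B (.push k a) Q s ↔
    (s.set k (a :: s.get k)).size ≤ B ∧ Q (s.set k (a :: s.get k)) :=
  ⟨fun ⟨_, h, hQ⟩ => by cases h with | push h => exact ⟨h, hQ⟩, fun h => ⟨_, .push h.1, h.2⟩⟩

theorem wp_pop {k : Stk} : WP B (.pop k) Q s ↔ Q (s.set k (s.get k).tail) :=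
  ⟨fun ⟨_, h, hQ⟩ => by cases h; exact hQ, fun h => ⟨_, .pop s k, h⟩⟩

theorem wp_seq {c d : Cmd} : WP B (.seq c d) Q s ↔ WP B c (WP B d Q) s :=
  ⟨fun ⟨_, h, hQ⟩ => by cases h with | seq h h' => exact ⟨_, h, _, h', hQ⟩,
    fun ⟨_, h, _, h', hQ⟩ => ⟨_, .seq h h', hQ⟩⟩

theorem wp_case {k : Stk} {f : Option Sym → Cmd} :
    WP B (.case k f) Q s ↔ WP B (f (s.get k).head?) Q s :=
  ⟨fun ⟨_, h, hQ⟩ => by cases h with | case h => exact ⟨_, h, hQ⟩,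
    fun ⟨_, h, hQ⟩ => ⟨_, .case h, hQ⟩⟩

/-- Loops get no invariant rule. They are unrolled by this rule and the next one, inside an
induction on the data consumed. -/
theorem wp_stop {k : Stk} {p : Option Sym → Bool} {c : Cmd} (hp : p (s.get k).head? = false)
    (h : Q s) : WP B (.loop k p c) Q s :=
  ⟨s, .loopEnd hp, h⟩

theorem wp_step {k : Stk} {p : Option Sym → Bool} {c : Cmd} (hp : p (s.get k).head? = true)
    (h : WP B c (WP B (.loop k p c) Q) s) : WP B (.loop k p c) Q s :=
  let ⟨_, h, _, h', hQ⟩ := h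
  ⟨_, .step hp h h', hQ⟩

/-! ### Moving symbols -/

def isBit : Option Sym → Bool
  | some (.bit _) => true
  | _ => false

def isTick : Option Sym → Bool
  | some .tick => true
  | _ => false

def notBit : Option Sym → Bool
  | some (.bit _) => false
  | some _ => true
  | none => false

def bitOf : Option Sym → Bool
  | some (.bit b) => b
  | _ => false

namespace Cmd

/-- Move the top of a stack, if any, to another stack. -/
def move (k k' : Stk) : Cmd :=
  case k fun
    | some a => seq (pop k) (push k' a)
    | none => skip

def moveWhile (k k' : Stk) (p : Option Sym → Bool) : Cmd := loop k p (move k k')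

def pour (k k' : Stk) : Cmd := moveWhile k k' Option.isSome

def clear (k : Stk) : Cmd := loop k Option.isSome (pop k)

end Cmd

theorem State.size_move {k k' : Stk} (hk : k ≠ k') {a : Sym} {y : List Sym}
    (h : s.get k = a :: y) : ((s.set k y).set k' (a :: s.get k')).size = s.size := by
  cases k <;> cases k' <;> first | exact absurd rfl hk |
    (simp only [get] at h; simp only [set, get, size, h, List.length_cons]; omega)

/-- The symbol is popped before it is pushed, so no spare cell is needed. -/
theorem wp_move {k k' : Stk} (hk : k ≠ k') {a : Sym} {y : List Sym} (h : s.get k = a :: y)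
    (hB : s.size ≤ B) (hQ : Q ((s.set k y).set k' (a :: s.get k'))) :
    WP B (.move k k') Q s := by
  rw [Cmd.move, wp_case, h]
  simp only [List.head?_cons, wp_seq, wp_pop, wp_push, h, List.tail_cons]
  rw [State.get_set, Function.update_of_ne hk.symm]
  exact ⟨(State.size_move hk h).trans_le hB, hQ⟩

theorem wp_moveWhile {k k' : Stk} (hk : k ≠ k') {p : Option Sym → Bool} (x y : List Sym)
    (h : s.get k = x ++ y) (hx : ∀ a ∈ x, p (some a) = true) (hy : p y.head? = false)
    (hB : s.size ≤ B) (hQ : Q ((s.set k y).set k' (x.reverse ++ s.get k'))) :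
    WP B (.moveWhile k k' p) Q s := by
  induction x generalizing s with
  | nil =>
    rw [List.nil_append] at h
    refine wp_stop (by rw [h, hy]) ?_
    rw [← h] at hQ
    cases k <;> cases k' <;> first | exact absurd rfl hk | exact hQ
  | cons a x ih =>
    refine wp_step (by rw [h]; exact hx a (by simp)) (wp_move hk h hB ?_)
    refine ih ?_ (fun b hb => hx b (by simp [hb])) ((State.size_move hk h).trans_le hB) ?_
    · simp [State.get_set, Function.update_of_ne hk]
    · rw [State.get_set, Function.update_self]
      rw [List.reverse_cons, List.append_assoc, List.singleton_append] at hQ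
      cases k <;> cases k' <;> first | exact absurd rfl hk | exact hQ

theorem wp_pour {k k' : Stk} (hk : k ≠ k') (hB : s.size ≤ B)
    (hQ : Q ((s.set k []).set k' ((s.get k).reverse ++ s.get k'))) :
    WP B (.pour k k') Q s :=
  wp_moveWhile hk (s.get k) [] (by simp) (by simp) rfl hB hQ

theorem wp_clear {k : Stk} (hQ : Q (s.set k [])) : WP B (.clear k) Q s := by
  generalize h : s.get k = x
  induction x generalizing s with
  | nil =>
    refine wp_stop (by rw [h]; rfl) ?_
    rw [← h] at hQ
    cases k <;> exact hQ
  | cons a x ih =>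
    refine wp_step (by rw [h]; rfl) ?_
    rw [wp_pop, h, List.tail_cons]
    refine ih ?_ (by rw [State.get_set, Function.update_self])
    cases k <;> exact hQ

/-! ### Columns

The values of the first `m` set variables on an element of the universe form a column, the last
variable on top. -/

/-- Columns on a stack. -/
def encodeColumns (cs : List (List Bool)) : List Sym :=
  cs.flatMap fun c => c.map Sym.bit ++ [Sym.tick]

theorem encodeColumns_nil : encodeColumns [] = [] := rfl

theorem encodeColumns_cons (c : List Bool) (cs : List (List Bool)) :
    encodeColumns (c :: cs) = c.map Sym.bit ++ Sym.tick :: encodeColumns cs := by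
  simp [encodeColumns]

theorem encodeColumns_append (cs cs' : List (List Bool)) :
    encodeColumns (cs ++ cs') = encodeColumns cs ++ encodeColumns cs' := by
  simp [encodeColumns]

theorem length_encodeColumns_map_cons (b : Bool) (cs : List (List Bool)) :
    (encodeColumns (cs.map (b :: ·))).length = (encodeColumns cs).length + cs.length := by
  induction cs with
  | nil => rfl
  | cons c cs ih =>
    simp only [List.map_cons, encodeColumns_cons, List.length_append, List.length_cons,
      List.length_map, ih]
    omega

theorem isBit_of_mem_map {c : List Bool} {a : Sym} (h : a ∈ c.map Sym.bit) :
    isBit (some a) = true := by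
  obtain ⟨b, -, rfl⟩ := List.mem_map.1 h
  rfl

namespace Cmd

def passColumn : Cmd := seq (moveWhile .col .don isBit) (move .col .don)

def addVar : Cmd :=
  seq (loop .col Option.isSome (seq (push .don (.bit false)) passColumn)) (pour .don .col)

def removeVar : Cmd :=
  seq (loop .col Option.isSome (seq (pop .col) passColumn)) (pour .don .col)

/-- Replace `true` by `false` on top of the columns until `false` is met. -/
def carry : Cmd :=
  loop .col bitOf (seq (pop .col) (seq (push .don (.bit false)) passColumn))

end Cmd

variable {i l r k d t κ v : List Sym}

theorem wp_passColumn {c : List Bool}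
    (hB : (State.mk i l r (c.map Sym.bit ++ Sym.tick :: k) d t κ v).size ≤ B)
    (hQ : Q ⟨i, l, r, k, (c.map Sym.bit ++ [Sym.tick]).reverse ++ d, t, κ, v⟩) :
    WP B .passColumn Q ⟨i, l, r, c.map Sym.bit ++ Sym.tick :: k, d, t, κ, v⟩ := by
  rw [Cmd.passColumn, wp_seq]
  refine wp_moveWhile (by decide) _ _ rfl (fun _ => isBit_of_mem_map) rfl hB ?_
  refine wp_move (by decide) rfl ?_ ?_
  · simp only [State.size, State.set, State.get, List.length_append, List.length_reverse,
      List.length_cons] at hB ⊢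
    omega
  · simpa [State.set, State.get] using hQ

theorem wp_addVar {cs : List (List Bool)}
    (hB : (State.mk i l r (encodeColumns cs) [] t κ v).size + cs.length ≤ B)
    (hQ : Q ⟨i, l, r, encodeColumns (cs.map (false :: ·)), [], t, κ, v⟩) :
    WP B .addVar Q ⟨i, l, r, encodeColumns cs, [], t, κ, v⟩ := by
  rw [Cmd.addVar, wp_seq]
  -- The induction must allow columns already passed, which lie on `don`.
  have key : ∀ d, (State.mk i l r (encodeColumns cs) d t κ v).size + cs.length ≤ B →
      (∀ d', d' = (encodeColumns (cs.map (false :: ·))).reverse ++ d →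
        WP B (.pour .don .col) Q ⟨i, l, r, [], d', t, κ, v⟩) →
      WP B (.loop .col Option.isSome (.seq (.push .don (.bit false)) .passColumn))
        (WP B (.pour .don .col) Q) ⟨i, l, r, encodeColumns cs, d, t, κ, v⟩ := by
    clear hB hQ
    induction cs with
    | nil => exact fun d _ h => wp_stop rfl (h d rfl)
    | cons c cs ih =>
      intro d hB h
      simp only [encodeColumns_cons, State.size, List.length_append, List.length_cons,
        List.length_map] at hB ⊢
      refine wp_step (by cases c <;> rfl) ?_
      rw [wp_seq, wp_push]
      refine ⟨?_, wp_passColumn ?_ (ih _ ?_ fun d' hd' => h d' ?_)⟩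
      · simp only [State.size, State.set, State.get, List.length_append, List.length_cons,
          List.length_map]
        omega
      · simp only [State.size, State.get, List.length_append, List.length_cons,
          List.length_map]
        omega
      · simp only [State.size, State.get, List.length_append, List.length_cons,
          List.length_map, List.length_reverse, List.length_nil]
        omega
      · rw [hd']
        simp [encodeColumns_cons, State.get]
  refine key [] hB ?_
  rintro d' rfl
  refine wp_pour (by decide) ?_ ?_
  · simp only [State.size, List.length_append, List.length_reverse, List.length_nil,
      length_encodeColumns_map_cons] at hB ⊢
    omega
  · simpa [State.set, State.get] using hQ

theorem wp_removeVar {b : Bool} {cs : List (List Bool)}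
    (hB : (State.mk i l r (encodeColumns (cs.map (b :: ·))) [] t κ v).size ≤ B)
    (hQ : Q ⟨i, l, r, encodeColumns cs, [], t, κ, v⟩) :
    WP B .removeVar Q ⟨i, l, r, encodeColumns (cs.map (b :: ·)), [], t, κ, v⟩ := by
  rw [Cmd.removeVar, wp_seq]
  have key : ∀ d, (State.mk i l r (encodeColumns (cs.map (b :: ·))) d t κ v).size ≤ B →
      (∀ d', d' = (encodeColumns cs).reverse ++ d →
        WP B (.pour .don .col) Q ⟨i, l, r, [], d', t, κ, v⟩) →
      WP B (.loop .col Option.isSome (.seq (.pop .col) .passColumn))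
        (WP B (.pour .don .col) Q) ⟨i, l, r, encodeColumns (cs.map (b :: ·)), d, t, κ, v⟩ := by
    clear hB hQ
    induction cs with
    | nil => exact fun d _ h => wp_stop rfl (h d rfl)
    | cons c cs ih =>
      intro d hB h
      simp only [List.map_cons, encodeColumns_cons, State.size, List.length_append,
        List.length_cons, List.length_map, List.cons_append] at hB ⊢
      refine wp_step rfl ?_
      rw [wp_seq, wp_pop]
      refine wp_passColumn ?_ (ih _ ?_ fun d' hd' => h d' ?_)
      · simp only [State.size, List.length_append, List.length_cons, List.length_map]
        omega
      · simp only [State.size, List.length_append, List.length_cons, List.length_map,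
          List.length_reverse, List.length_nil]
        omega
      · rw [hd']
        simp [encodeColumns_cons]
  refine key [] hB ?_
  rintro d' rfl
  refine wp_pour (by decide) ?_ ?_
  · simp only [State.size, List.length_append, List.length_reverse, List.length_nil,
      length_encodeColumns_map_cons] at hB ⊢
    omega
  · simpa [State.set, State.get] using hQ

/-- The top bits of successive columns are the digits of a binary counter, lowest first; this is the
run of ones that an increment turns into zeros. The condition on `k` covers both ways to stop, a
digit zero and the bottom of the stack, which means overflow. -/
theorem wp_carry {cs : List (List Bool)} (hk : bitOf k.head? = false)
    (hB : (State.mk i l r (encodeColumns (cs.map (true :: ·)) ++ k) d t κ v).size ≤ B)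
    (hQ : Q ⟨i, l, r, k, (encodeColumns (cs.map (false :: ·))).reverse ++ d, t, κ, v⟩) :
    WP B .carry Q ⟨i, l, r, encodeColumns (cs.map (true :: ·)) ++ k, d, t, κ, v⟩ := by
  induction cs generalizing d with
  | nil => exact wp_stop hk hQ
  | cons c cs ih =>
    simp only [List.map_cons, encodeColumns_cons, State.size, List.length_append,
      List.length_cons, List.length_map, List.cons_append, List.append_assoc] at hB ⊢
    refine wp_step rfl ?_
    rw [wp_seq, wp_pop, wp_seq, wp_push]
    refine ⟨?_, wp_passColumn ?_ (ih ?_ ?_)⟩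
    · simp only [State.size, State.set, State.get, List.length_append, List.length_cons,
        List.length_map, List.tail_cons]
      omega
    · simp only [State.size, State.set, State.get, List.length_append, List.length_cons,
        List.length_map]
      omega
    · simp only [State.size, State.set, State.get, List.length_append, List.length_cons,
        List.length_map, List.length_reverse, List.length_nil]
      omega
    · simpa [encodeColumns_cons, State.get, State.set] using hQ

end BAPA

/-! ### The evaluator, and its correctness on set terms. -/

namespace BAPA

/-! ### The evaluator

The formula is in Polish notation on `lft` (the part already read, reversed) and `rgt`. The stack
`ctl` holds the symbols whose operands are being evaluated, covered by the value of their first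
operand when there is one. A set quantifier, and also an atom, which is a quantifier over elements,
puts a mark on `lft`, to which the reading returns in each iteration; below its symbol on `ctl` is
the value accumulated so far. The value of the operand read last is on `val`. -/

namespace Cmd

/-- Back to the last mark. -/
def rewind : Cmd := moveWhile .lft .rgt notBit

/-- Delete the last mark, staying at the present place. -/
def unmark : Cmd :=
  seq (push .rgt (.bit true)) <| seq rewind <| seq (pop .lft) <|
    seq (moveWhile .rgt .lft notBit) (pop .rgt)

/-- The last variable is on top of the column, so the column is first reversed onto `tmp`. Each tick
of the unary index puts one bit back, after which the wanted bit is on top. -/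
def evalVar : Cmd :=
  seq (move .rgt .lft) <| seq (moveWhile .col .tmp isBit) <|
    seq (loop .rgt isTick (seq (move .rgt .lft) (move .tmp .col))) <|
      seq (case .tmp fun o => push .val (.bit (bitOf o))) (pour .tmp .col)

/-- Bits can serve as marks on `lft` because the encoding of a formula contains none. -/
def enter (a : Sym) (b : Bool) : Cmd :=
  seq (move .rgt .lft) <| seq (push .lft (.bit true)) <| seq (push .ctl (.bit b)) (push .ctl a)

def read : Cmd :=
  case .rgt fun
    | none | some (.bit _) | some .tick => skip
    | some .var => evalVar
    | some .empty => seq (move .rgt .lft) (push .val (.bit false))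
    | some .univ => seq (move .rgt .lft) (push .val (.bit true))
    | some .eq => enter .eq true
    | some .subset => enter .subset true
    | some .ex => seq (enter .ex false) addVar
    | some .all => seq (enter .all true) addVar
    | some a => seq (move .rgt .lft) (push .ctl a)

/-- The end of a loop, the accumulated value becoming the value of the operand. -/
def leave : Cmd :=
  seq (pop .ctl) <| seq (case .ctl fun o => seq (pop .ctl) (push .val (.bit (bitOf o)))) unmark

/-- Accumulate the value of an atom on an element; go on with the next element. -/
def endElement (a : Sym) (b : Bool) : Cmd :=
  case .col fun
    | none => seq (pour .don .col) leave
    | some _ =>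
        seq (if b then skip else
          seq (pop .ctl) (seq (pop .ctl) (seq (push .ctl (.bit false)) (push .ctl a))))
          (seq passColumn rewind)

/-- Accumulate the value of a formula for a set; go on with the next set. -/
def endSet (a : Sym) (f : Bool → Bool) : Cmd :=
  seq (pop .val) <| seq (pop .ctl) <|
    seq (case .ctl fun o =>
      seq (pop .ctl) (seq (push .ctl (.bit (f (bitOf o)))) (push .ctl a))) <|
    seq carry <| case .col fun
      | none => seq (pour .don .col) (seq removeVar leave)
      | some _ => seq (pop .col) (seq (push .col (.bit true)) (seq (pour .don .col) rewind))

/-- The operations with two operands, atoms being considered on one element. -/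
def binary : Sym → Bool → Bool → Bool
  | .union, b, b' => b || b'
  | .or, b, b' => b || b'
  | .inter, b, b' => b && b'
  | .and, b, b' => b && b'
  | .eq, b, b' => b == b'
  | .subset, b, b' => !b || b'
  | _, _, _ => false

/-- The accumulation of values in the loops for set quantifiers. -/
def accumulate : Sym → Bool → Bool → Bool
  | .ex, b, b' => b || b'
  | _, b, b' => b && b'

/-- The top of `ctl` tells what the finished operand is for. A bit is the value of the first
operand, so this was the second; a binary symbol or an atom means that this was the first; `tick` is
the bottom, and removing it ends `eval`. -/
def ret (b : Bool) : Cmd :=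
  case .ctl fun
    | some .compl | some .not => seq (pop .ctl) (seq (pop .val) (push .val (.bit !b)))
    | some (.bit b') =>
        seq (pop .ctl) <| seq (pop .val) <| case .ctl fun
          | some .eq => endElement .eq (binary .eq b' b)
          | some .subset => endElement .subset (binary .subset b' b)
          | some a => seq (pop .ctl) (push .val (.bit (binary a b' b)))
          | none => skip
    | some .ex => endSet .ex (accumulate .ex · b)
    | some .all => endSet .all (accumulate .all · b)
    | some .tick => pop .ctl
    | some _ => seq (pop .val) (push .ctl (.bit b))
    | none => skip

def evalStep : Cmd :=
  case .val fun
    | some (.bit b) => ret b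
    | _ => read

/-- Evaluate the formula on `rgt`, with `tick` on `ctl`. -/
def eval : Cmd := loop .ctl Option.isSome evalStep

end Cmd

variable {B : ℕ} {Q : State → Prop} {i l r k d t κ v : List Sym}

theorem wp_eval_step {s : State} (hs : s.ctl ≠ []) (h : WP B .evalStep (WP B .eval Q) s) :
    WP B .eval Q s := by
  refine wp_step ?_ h
  rw [State.get]
  cases hc : s.ctl
  · exact absurd hc hs
  · rfl

theorem wp_rewind {b : Bool} {x : List Sym} (hx : ∀ a ∈ x, notBit (some a) = true)
    (hB : (State.mk i (x.reverse ++ .bit b :: l) r k d t κ v).size ≤ B)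
    (hQ : Q ⟨i, .bit b :: l, x ++ r, k, d, t, κ, v⟩) :
    WP B .rewind Q ⟨i, x.reverse ++ .bit b :: l, r, k, d, t, κ, v⟩ := by
  refine wp_moveWhile (by decide) _ _ rfl (fun a ha => hx a (by simpa using ha)) rfl hB ?_
  simpa [State.set, State.get] using hQ

/-- A second mark, on `rgt`, keeps the reading position while the first one is sought; hence the one
spare cell. -/
theorem wp_unmark {b : Bool} {x : List Sym} (hx : ∀ a ∈ x, notBit (some a) = true)
    (hB : (State.mk i (x.reverse ++ .bit b :: l) r k d t κ v).size + 1 ≤ B)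
    (hQ : Q ⟨i, x.reverse ++ l, r, k, d, t, κ, v⟩) :
    WP B .unmark Q ⟨i, x.reverse ++ .bit b :: l, r, k, d, t, κ, v⟩ := by
  simp only [State.size, List.length_append, List.length_cons, List.length_reverse] at hB
  rw [Cmd.unmark, wp_seq, wp_push, wp_seq]
  refine ⟨?_, wp_rewind hx ?_ ?_⟩
  · simp only [State.size, State.set, State.get, List.length_append, List.length_cons,
      List.length_reverse]
    omega
  · simp only [State.size, State.get, List.length_append, List.length_cons, List.length_reverse]
    omega
  · rw [wp_seq, wp_pop, wp_seq]
    refine wp_moveWhile (by decide) x (.bit true :: r) rfl hx rfl ?_ ?_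
    · simp only [State.size, State.set, State.get, List.length_append, List.length_cons,
        List.tail_cons]
      omega
    · rw [wp_pop]
      exact hQ

/-! ### Encodings -/

theorem SetTerm.isTick_head_encode {m : ℕ} (a : SetTerm (Fin m)) (r : List Sym) :
    isTick (a.encode ++ r).head? = false := by
  cases a <;> rfl

theorem BAFormula.isTick_head_encode {m : ℕ} (F : BAFormula m) (r : List Sym) :
    isTick (F.encode ++ r).head? = false := by
  cases F <;> rfl

theorem SetTerm.notBit_of_mem_encode {m : ℕ} (a : SetTerm (Fin m)) :
    ∀ x ∈ a.encode, notBit (some x) = true := by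
  induction a with
  | var y =>
    intro x hx
    simp only [SetTerm.encode, List.mem_cons, List.mem_replicate] at hx
    rcases hx with rfl | ⟨-, rfl⟩ <;> rfl
  | empty | univ => simp [SetTerm.encode, notBit]
  | union a b iha ihb | inter a b iha ihb =>
    simp only [SetTerm.encode, List.forall_mem_cons, List.forall_mem_append]
    exact ⟨rfl, iha, ihb⟩
  | compl a iha =>
    simp only [SetTerm.encode, List.forall_mem_cons]
    exact ⟨rfl, iha⟩

theorem BAFormula.notBit_of_mem_encode {m : ℕ} (F : BAFormula m) :
    ∀ x ∈ F.encode, notBit (some x) = true := by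
  induction F with
  | eq a b | subset a b =>
    simp only [BAFormula.encode, List.forall_mem_cons, List.forall_mem_append]
    exact ⟨rfl, a.notBit_of_mem_encode, b.notBit_of_mem_encode⟩
  | and F G ihF ihG | or F G ihF ihG =>
    simp only [BAFormula.encode, List.forall_mem_cons, List.forall_mem_append]
    exact ⟨rfl, ihF, ihG⟩
  | not F ih | ex F ih | all F ih =>
    simp only [BAFormula.encode, List.forall_mem_cons]
    exact ⟨rfl, ih⟩

/-! ### Evaluation of terms -/

theorem wp_evalVar {n : ℕ} {c : List Bool} (hk : isBit k.head? = false)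
    (hr : isTick r.head? = false)
    (hB : (State.mk i l (.var :: (List.replicate n .tick ++ r)) (c.map .bit ++ k) d [] κ []).size
      + 1 ≤ B)
    (hQ : Q ⟨i, List.replicate n .tick ++ .var :: l, r, c.map .bit ++ k, d, [], κ,
      [.bit (c.reverse[n]?.getD false)]⟩) :
    WP B .evalVar Q
      ⟨i, l, .var :: (List.replicate n .tick ++ r), c.map .bit ++ k, d, [], κ, []⟩ := by
  simp only [State.size, List.length_append, List.length_cons, List.length_replicate,
    List.length_map, List.length_nil] at hB
  rw [Cmd.evalVar, wp_seq]
  refine wp_move (by decide) rfl ?_ ?_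
  · simp only [State.size, List.length_append, List.length_cons, List.length_replicate,
      List.length_map, List.length_nil]
    omega
  rw [wp_seq]
  refine wp_moveWhile (by decide) (c.map .bit) k rfl (fun _ => isBit_of_mem_map) hk ?_ ?_
  · simp only [State.size, State.set, State.get, List.length_append, List.length_cons,
      List.length_replicate, List.length_map, List.length_nil]
    omega
  simp only [State.set, State.get, List.append_nil, ← List.map_reverse]
  rw [wp_seq]
  have key : ∀ (n : ℕ) (l k : List Sym) (c' : List Bool),
      i.length + l.length + (n + r.length) + k.length + d.length + c'.length + κ.length + 1 ≤ B →
      Q ⟨i, List.replicate n .tick ++ l, r, (c'.map .bit).reverse ++ k, d, [], κ,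
        [.bit (c'[n]?.getD false)]⟩ →
      WP B (.loop .rgt isTick (.seq (.move .rgt .lft) (.move .tmp .col)))
        (WP B (.seq (.case .tmp fun o => .push .val (.bit (bitOf o))) (.pour .tmp .col)) Q)
        ⟨i, l, List.replicate n .tick ++ r, k, d, c'.map .bit, κ, []⟩ := by
    clear hB hQ hk
    intro n
    induction n with
    | zero =>
      intro l k c' hB hQ
      refine wp_stop hr ?_
      rw [wp_seq, wp_case, wp_push]
      refine ⟨?_, wp_pour (by decide) ?_ ?_⟩
      · simp only [State.size, State.set, State.get, List.length_cons, List.length_map,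
          List.length_nil, List.length_append, List.length_replicate]
        omega
      · simp only [State.size, State.set, State.get, List.length_cons, List.length_map,
          List.length_nil, List.length_append, List.length_replicate]
        omega
      · cases c' <;> simpa [State.set, State.get, bitOf] using hQ
    | succ n ih =>
      intro l k c' hB hQ
      refine wp_step rfl ?_
      rw [wp_seq]
      refine wp_move (a := .tick) (y := List.replicate n .tick ++ r) (by decide) rfl ?_ ?_
      · simp only [State.size, List.length_append, List.length_replicate, List.length_map,
          List.length_nil]
        omega
      cases c' with
      | nil =>
        -- With an index beyond the column, `move` is idle on the empty stack, which agrees with the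
        -- default `false` of `getD`. Thus columns of any length are admitted.
        rw [Cmd.move, wp_case]
        change WP B .skip _ _
        rw [wp_skip]
        refine ih (.tick :: l) k [] ?_ ?_
        · simp only [List.length_cons, List.length_nil] at hB ⊢
          omega
        · simpa [List.replicate_succ', List.append_assoc] using hQ
      | cons b c' =>
        refine wp_move (a := .bit b) (y := c'.map .bit) (by decide) rfl ?_
          (ih (.tick :: l) (.bit b :: k) c' ?_ ?_)
        · simp only [State.size, State.set, State.get, List.length_append, List.length_replicate,
            List.length_map, List.length_nil, List.length_cons] at hB ⊢
          omega
        · simp only [List.length_cons] at hB ⊢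
          omega
        · simpa [List.replicate_succ', List.append_assoc] using hQ
  refine key n _ k _ ?_ ?_
  · simp only [List.length_cons, List.length_reverse]
    omega
  · simpa [List.map_reverse] using hQ

def isBinary : Sym → Bool
  | .union | .inter | .and | .or => true
  | _ => false

def isUnary : Sym → Bool
  | .compl | .not => true
  | _ => false

def isAtomic : Sym → Bool
  | .eq | .subset => true
  | _ => false

/-- All symbols allowed by `ho` take the same branch of the program. That branch is verified once,
and the other symbols contradict `ho`; the lemmas below follow the same pattern. -/
theorem wp_eval_open {o : Sym} (ho : isBinary o || isUnary o) (hκ : κ ≠ [])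
    (hB : (State.mk i l (o :: r) k d t κ []).size + 1 ≤ B)
    (hQ : WP B .eval Q ⟨i, o :: l, r, k, d, t, o :: κ, []⟩) :
    WP B .eval Q ⟨i, l, o :: r, k, d, t, κ, []⟩ := by
  simp only [State.size, List.length_cons, List.length_nil] at hB
  refine wp_eval_step hκ ?_
  have h : WP B (.seq (.move .rgt .lft) (.push .ctl o)) (WP B .eval Q)
      ⟨i, l, o :: r, k, d, t, κ, []⟩ := by
    rw [wp_seq]
    refine wp_move (by decide) rfl ?_ (wp_push.2 ⟨?_, hQ⟩)
    · simp only [State.size, List.length_cons, List.length_nil]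
      omega
    · simp only [State.size, State.set, State.get, List.length_cons, List.length_nil]
      omega
  rw [Cmd.evalStep, wp_case]
  refine wp_case.2 ?_
  cases o <;> first | exact absurd ho Bool.false_ne_true | exact h

theorem wp_eval_first {o : Sym} (ho : isBinary o || isAtomic o) {b : Bool}
    (hB : (State.mk i l r k d t (o :: κ) [.bit b]).size ≤ B)
    (hQ : WP B .eval Q ⟨i, l, r, k, d, t, .bit b :: o :: κ, []⟩) :
    WP B .eval Q ⟨i, l, r, k, d, t, o :: κ, [.bit b]⟩ := by
  simp only [State.size, List.length_cons, List.length_nil] at hB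
  refine wp_eval_step (by simp) ?_
  have h : WP B (.seq (.pop .val) (.push .ctl (.bit b))) (WP B .eval Q)
      ⟨i, l, r, k, d, t, o :: κ, [.bit b]⟩ := by
    rw [wp_seq, wp_pop, wp_push]
    refine ⟨?_, hQ⟩
    simp only [State.size, State.set, State.get, List.length_cons, List.length_nil, List.tail_cons]
    omega
  rw [Cmd.evalStep, wp_case]
  refine wp_case.2 ?_
  cases o <;> first | exact absurd ho Bool.false_ne_true | exact h

theorem wp_eval_second {o : Sym} (ho : isBinary o) {b b' : Bool}
    (hB : (State.mk i l r k d t (.bit b :: o :: κ) [.bit b']).size ≤ B)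
    (hQ : WP B .eval Q ⟨i, l, r, k, d, t, κ, [.bit (Cmd.binary o b b')]⟩) :
    WP B .eval Q ⟨i, l, r, k, d, t, .bit b :: o :: κ, [.bit b']⟩ := by
  simp only [State.size, List.length_cons, List.length_nil] at hB
  refine wp_eval_step (by simp) ?_
  have h : WP B (.seq (.pop .ctl) (.push .val (.bit (Cmd.binary o b b')))) (WP B .eval Q)
      ⟨i, l, r, k, d, t, o :: κ, []⟩ := by
    rw [wp_seq, wp_pop, wp_push]
    refine ⟨?_, hQ⟩
    simp only [State.size, State.set, State.get, List.length_cons, List.length_nil, List.tail_cons]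
    omega
  rw [Cmd.evalStep, wp_case]
  refine wp_case.2 (wp_seq.2 (wp_pop.2 (wp_seq.2 (wp_pop.2 (wp_case.2 ?_)))))
  cases o <;> first | exact absurd ho Bool.false_ne_true | exact h

theorem wp_eval_unary {o : Sym} (ho : isUnary o) {b : Bool}
    (hB : (State.mk i l r k d t (o :: κ) [.bit b]).size ≤ B)
    (hQ : WP B .eval Q ⟨i, l, r, k, d, t, κ, [.bit !b]⟩) :
    WP B .eval Q ⟨i, l, r, k, d, t, o :: κ, [.bit b]⟩ := by
  simp only [State.size, List.length_cons, List.length_nil] at hB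
  refine wp_eval_step (by simp) ?_
  have h : WP B (.seq (.pop .ctl) (.seq (.pop .val) (.push .val (.bit !b)))) (WP B .eval Q)
      ⟨i, l, r, k, d, t, o :: κ, [.bit b]⟩ := by
    rw [wp_seq, wp_pop, wp_seq, wp_pop, wp_push]
    refine ⟨?_, hQ⟩
    simp only [State.size, State.set, State.get, List.length_cons, List.length_nil, List.tail_cons]
    omega
  rw [Cmd.evalStep, wp_case]
  refine wp_case.2 ?_
  cases o <;> first | exact absurd ho Bool.false_ne_true | exact h

/-- With columns `k` on `col` and `d` on `don`, and with `n` cells to spare, the text `x` is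
evaluated to `b`. -/
def Evaluates (B : ℕ) (i k d x : List Sym) (n : ℕ) (b : Bool) : Prop :=
  ∀ ⦃Q : State → Prop⦄ ⦃l r κ : List Sym⦄, isTick r.head? = false → κ ≠ [] →
    (State.mk i l (x ++ r) k d [] κ []).size + n ≤ B →
    WP B .eval Q ⟨i, x.reverse ++ l, r, k, d, [], κ, [.bit b]⟩ →
    WP B .eval Q ⟨i, l, x ++ r, k, d, [], κ, []⟩

/-- The operands are evaluated one after the other, so adding their allowances is generous, but it
keeps the bound linear in the size. The stacks `col` and `don` are the same after an operand as
before it, which makes the two runs composable. -/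
theorem Evaluates.binary {o : Sym} (ho : isBinary o) {x y : List Sym} {n n' : ℕ} {b b' : Bool}
    (hx : Evaluates B i k d x n b) (hy : Evaluates B i k d y n' b')
    (ht : ∀ r, isTick (y ++ r).head? = false) :
    Evaluates B i k d (o :: (x ++ y)) (n + n' + 3) (Cmd.binary o b b') := by
  intro Q l r κ hr hκ hB hQ
  simp only [State.size, List.length_append, List.length_cons, List.length_nil] at hB
  rw [List.cons_append, List.append_assoc]
  refine wp_eval_open (by simp [ho]) hκ ?_ (hx (ht r) (by simp) ?_
    (wp_eval_first (by simp [ho]) ?_ (hy hr (by simp) ?_ (wp_eval_second ho ?_ ?hQ))))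
  case hQ => simpa using hQ
  all_goals
    simp only [State.size, List.length_append, List.length_cons, List.length_nil,
      List.length_reverse]
    omega

theorem Evaluates.unary {o : Sym} (ho : isUnary o) {x : List Sym} {n : ℕ} {b : Bool}
    (hx : Evaluates B i k d x n b) : Evaluates B i k d (o :: x) (n + 2) (!b) := by
  intro Q l r κ hr hκ hB hQ
  simp only [State.size, List.length_append, List.length_cons, List.length_nil] at hB
  rw [List.cons_append]
  refine wp_eval_open (by simp [ho]) hκ ?_ (hx hr (by simp) ?_ (wp_eval_unary ho ?_ ?hQ))
  case hQ => simpa using hQ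
  all_goals
    simp only [State.size, List.length_append, List.length_cons, List.length_nil,
      List.length_reverse]
    omega

theorem Evaluates.mono {x : List Sym} {n n' : ℕ} {b : Bool} (h : Evaluates B i k d x n b)
    (hn : n ≤ n') : Evaluates B i k d x n' b :=
  fun _ _ _ _ hr hκ hB hQ => h hr hκ ((Nat.add_le_add_left hn _).trans hB) hQ

theorem evaluates_empty : Evaluates B i k d [.empty] 1 false := by
  intro Q l r κ hr hκ hB hQ
  refine wp_eval_step hκ ?_
  simp only [State.size, List.length_append, List.length_cons, List.length_nil] at hB
  rw [Cmd.evalStep, wp_case]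
  refine wp_case.2 (wp_seq.2 (wp_move (a := .empty) (y := r) (by decide) rfl ?_
    (wp_push.2 ⟨?_, hQ⟩)))
  all_goals
    simp only [State.size, State.set, State.get, List.length_append, List.length_cons,
      List.length_nil]
    omega

theorem evaluates_univ : Evaluates B i k d [.univ] 1 true := by
  intro Q l r κ hr hκ hB hQ
  refine wp_eval_step hκ ?_
  simp only [State.size, List.length_append, List.length_cons, List.length_nil] at hB
  rw [Cmd.evalStep, wp_case]
  refine wp_case.2 (wp_seq.2 (wp_move (a := .univ) (y := r) (by decide) rfl ?_
    (wp_push.2 ⟨?_, hQ⟩)))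
  all_goals
    simp only [State.size, State.set, State.get, List.length_append, List.length_cons,
      List.length_nil]
    omega

/-- The value of a term on the element with column `c`. -/
def SetTerm.onColumn {m : ℕ} (a : SetTerm (Fin m)) (c : List Bool) : Bool :=
  a.contains fun x : Fin m => c.reverse[(x : ℕ)]?.getD false

theorem SetTerm.evaluates {m : ℕ} (a : SetTerm (Fin m)) {c : List Bool}
    (hk : isBit k.head? = false) :
    Evaluates B i (c.map .bit ++ k) d a.encode (3 * a.size) (a.onColumn c) := by
  induction a with
  | var x =>
    intro Q l r κ hr hκ hB hQ
    simp only [State.size, List.length_append, SetTerm.encode, List.length_cons,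
      List.length_nil, SetTerm.size, List.length_replicate] at hB
    refine wp_eval_step hκ (wp_case.2 (wp_case.2 (wp_evalVar hk hr ?_ ?_)))
    · simp only [State.size, List.length_append, List.length_cons, List.length_nil,
        List.length_replicate]
      omega
    · simpa [SetTerm.encode, SetTerm.onColumn, SetTerm.contains] using hQ
  | empty => exact evaluates_empty.mono (by simp [SetTerm.size])
  | univ => exact evaluates_univ.mono (by simp [SetTerm.size])
  | union a b iha ihb =>
    exact (iha.binary rfl ihb b.isTick_head_encode (o := .union)).mono
      (by simp only [SetTerm.size]; omega)
  | inter a b iha ihb =>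
    exact (iha.binary rfl ihb b.isTick_head_encode (o := .inter)).mono
      (by simp only [SetTerm.size]; omega)
  | compl a iha =>
    exact (iha.unary rfl (o := .compl)).mono (by simp only [SetTerm.size]; omega)

end BAPA

/-! ### The two loops of the evaluator: over elements for atoms, over subsets for quantifiers. -/

namespace BAPA

variable {B : ℕ} {Q : State → Prop} {i l r k d t κ v : List Sym}

/-! ### Evaluation of atoms -/

theorem wp_enter {o : Sym} {b : Bool} (hB : (State.mk i l (o :: r) k d t κ v).size + 3 ≤ B)
    (hQ : Q ⟨i, .bit true :: o :: l, r, k, d, t, o :: .bit b :: κ, v⟩) :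
    WP B (.enter o b) Q ⟨i, l, o :: r, k, d, t, κ, v⟩ := by
  simp only [State.size, List.length_cons] at hB
  refine wp_seq.2 (wp_move (by decide) rfl ?_ (wp_seq.2 (wp_push.2 ⟨?_, wp_seq.2 (wp_push.2
    ⟨?_, wp_push.2 ⟨?_, hQ⟩⟩)⟩)))
  all_goals
    simp only [State.size, State.set, State.get, List.length_cons]
    omega

theorem wp_leave {o : Sym} {b b' : Bool} {x : List Sym} (hx : ∀ a ∈ x, notBit (some a) = true)
    (hB : (State.mk i (x.reverse ++ .bit b' :: l) r k d t (o :: .bit b :: κ) []).size ≤ B)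
    (hQ : Q ⟨i, x.reverse ++ l, r, k, d, t, κ, [.bit b]⟩) :
    WP B .leave Q ⟨i, x.reverse ++ .bit b' :: l, r, k, d, t, o :: .bit b :: κ, []⟩ := by
  simp only [State.size, List.length_cons, List.length_append, List.length_nil,
    List.length_reverse] at hB
  refine wp_seq.2 (wp_pop.2 (wp_seq.2 (wp_case.2 (wp_seq.2 (wp_pop.2 (wp_push.2
    ⟨?_, wp_unmark hx ?_ hQ⟩))))))
  all_goals
    simp only [State.size, State.set, State.get, List.length_cons, List.length_append,
      List.length_reverse, List.tail_cons, List.length_nil]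
    omega

theorem wp_eval_element {o : Sym} (ho : isAtomic o) {b b' : Bool}
    (hQ : WP B (.endElement o (Cmd.binary o b b')) (WP B .eval Q)
      ⟨i, l, r, k, d, t, o :: κ, []⟩) :
    WP B .eval Q ⟨i, l, r, k, d, t, .bit b :: o :: κ, [.bit b']⟩ := by
  refine wp_eval_step (by simp) ?_
  rw [Cmd.evalStep, wp_case]
  refine wp_case.2 (wp_seq.2 (wp_pop.2 (wp_seq.2 (wp_pop.2 (wp_case.2 ?_)))))
  cases o <;> first | exact absurd ho Bool.false_ne_true | exact hQ

/-- Loop invariant: the columns `done` have been treated, `todo` remain, and `u` is the conjunction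
so far. Conjunction is right because equality and inclusion of sets are tested element by element.
-/
theorem wp_eval_elements {o : Sym} (ho : isAtomic o) {m : ℕ} (a b : SetTerm (Fin m))
    (hr : isTick r.head? = false) (todo : List (List Bool)) {done : List (List Bool)} {u : Bool}
    (hB : (State.mk i (.bit true :: o :: l) (a.encode ++ b.encode ++ r) (encodeColumns todo)
      (encodeColumns done).reverse [] (o :: .bit u :: κ) []).size + 3 * (a.size + b.size) + 2 ≤ B)
    (hQ : WP B .eval Q ⟨i, (a.encode ++ b.encode).reverse ++ o :: l, r,
      encodeColumns (done ++ todo), [], [], κ,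
      [.bit (u && todo.all fun c => Cmd.binary o (a.onColumn c) (b.onColumn c))]⟩) :
    WP B .eval Q ⟨i, .bit true :: o :: l, a.encode ++ b.encode ++ r, encodeColumns todo,
      (encodeColumns done).reverse, [], o :: .bit u :: κ, []⟩ := by
  have hx : ∀ x ∈ a.encode ++ b.encode, notBit (some x) = true :=
    List.forall_mem_append.2 ⟨a.notBit_of_mem_encode, b.notBit_of_mem_encode⟩
  have body {c : List Bool} {k d : List Sym} {u : Bool} (hk : isBit k.head? = false)
      (hB : (State.mk i (.bit true :: o :: l) (a.encode ++ b.encode ++ r) (c.map .bit ++ k) d []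
        (o :: .bit u :: κ) []).size + 3 * (a.size + b.size) + 2 ≤ B)
      (h : WP B (.endElement o (Cmd.binary o (a.onColumn c) (b.onColumn c))) (WP B .eval Q)
        ⟨i, (a.encode ++ b.encode).reverse ++ .bit true :: o :: l, r, c.map .bit ++ k, d, [],
          o :: .bit u :: κ, []⟩) :
      WP B .eval Q ⟨i, .bit true :: o :: l, a.encode ++ b.encode ++ r, c.map .bit ++ k, d, [],
        o :: .bit u :: κ, []⟩ := by
    simp only [State.size, List.length_cons, List.length_append, List.length_nil] at hB
    rw [List.append_assoc]
    refine a.evaluates hk (b.isTick_head_encode r) (by simp) ?_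
      (wp_eval_first (by simp [ho]) ?_ (b.evaluates hk hr (by simp) ?_ (wp_eval_element ho ?h)))
    case h => simpa using h
    all_goals
      simp only [State.size, List.length_append, List.length_cons, List.length_nil,
        List.length_reverse]
      omega
  induction todo generalizing done u with
  | nil =>
    -- The exit test follows the evaluation, so the terms are evaluated once more with no column
    -- left, and the result is discarded. In particular atoms are true over the empty universe.
    refine body (c := []) (k := []) rfl hB (wp_case.2 (wp_seq.2 (wp_pour (by decide) ?_
      (wp_leave hx ?_ ?h))))
    case h => simpa [State.get, State.set] using hQ
    all_goals
      simp only [State.size, State.get, State.set, List.length_append, List.length_cons,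
        List.length_nil, List.length_reverse, List.map_nil, encodeColumns_nil] at hB ⊢
      omega
  | cons c todo ih =>
    simp only [encodeColumns_cons] at hB ⊢
    refine body rfl hB ?_
    simp only [State.size, List.length_append, List.length_cons, List.length_nil,
      List.length_reverse, List.length_map] at hB
    rw [List.all_cons] at hQ
    -- Conjunction is carried out by leaving `u` alone if the new value is true and overwriting it
    -- with `false` otherwise; both cases continue from here.
    have key {u' : Bool} (hu : u' = (u && Cmd.binary o (a.onColumn c) (b.onColumn c))) :
        WP B (.seq .passColumn .rewind) (WP B .eval Q)
          ⟨i, (a.encode ++ b.encode).reverse ++ .bit true :: o :: l, r,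
            c.map .bit ++ .tick :: encodeColumns todo, (encodeColumns done).reverse, [],
            o :: .bit u' :: κ, []⟩ := by
      refine wp_seq.2 (wp_passColumn ?_ (wp_rewind hx ?_ ?_))
      · simp only [State.size, List.length_append, List.length_cons, List.length_nil,
          List.length_reverse, List.length_map]
        omega
      · simp only [State.size, List.length_append, List.length_cons, List.length_nil,
          List.length_reverse, List.length_map]
        omega
      · rw [← List.reverse_append, show encodeColumns done ++ (c.map Sym.bit ++ [Sym.tick]) =
          encodeColumns (done ++ [c]) by simp [encodeColumns]]
        refine ih ?_ ?_
        · simp only [State.size, List.length_append, List.length_cons, List.length_nil,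
            List.length_reverse, List.length_map, encodeColumns_append, encodeColumns_cons,
            encodeColumns_nil]
          omega
        · simpa [hu, Bool.and_assoc] using hQ
    have hend : WP B (.seq (if Cmd.binary o (a.onColumn c) (b.onColumn c) then .skip else
        .seq (.pop .ctl) (.seq (.pop .ctl) (.seq (.push .ctl (.bit false)) (.push .ctl o))))
        (.seq .passColumn .rewind)) (WP B .eval Q)
          ⟨i, (a.encode ++ b.encode).reverse ++ .bit true :: o :: l, r,
            c.map .bit ++ .tick :: encodeColumns todo, (encodeColumns done).reverse, [],
            o :: .bit u :: κ, []⟩ := by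
      rw [wp_seq]
      cases h : Cmd.binary o (a.onColumn c) (b.onColumn c)
      · refine wp_seq.2 (wp_pop.2 (wp_seq.2 (wp_pop.2 (wp_seq.2 (wp_push.2 ⟨?_, wp_push.2
          ⟨?_, key (by simp [h])⟩⟩)))))
        all_goals
          simp only [State.size, State.set, State.get, List.length_append, List.length_cons,
            List.length_nil, List.length_reverse, List.length_map, List.tail_cons]
          omega
      · exact wp_skip.2 (key (by simp [h]))
    rw [Cmd.endElement, wp_case]
    cases c <;> exact hend

/-! ### Enumeration of the subsets -/

/-- Bit vectors in the order of binary counting, least significant bit first. -/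
def vectors : ℕ → List (List Bool)
  | 0 => [[]]
  | n + 1 => (vectors n).flatMap fun w => [false :: w, true :: w]

theorem mem_vectors {n : ℕ} {w : List Bool} : w ∈ vectors n ↔ w.length = n := by
  induction n generalizing w with
  | zero => simp [vectors]
  | succ n ih =>
    cases w with
    | nil => simp [vectors]
    | cons b w => cases b <;> simp [vectors, ih]

/-- Each entry is the successor of the previous one, and the last one has no successor. -/
def Counting : List (List Bool) → Prop
  | [] => True
  | [w] => w = List.replicate w.length true
  | w :: w' :: ws =>
      (∃ n u, w = List.replicate n true ++ false :: u ∧ w' = List.replicate n false ++ true :: u) ∧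
        Counting (w' :: ws)

/-- A new lowest digit is added. From `false :: w` to `true :: w` there is no carry; from `true ::
w` to the next pair the carry of `w` grows by one digit. -/
theorem Counting.flatMap {ws : List (List Bool)} (h : Counting ws) :
    Counting (ws.flatMap fun w => [false :: w, true :: w]) := by
  induction ws with
  | nil => trivial
  | cons w ws ih =>
    cases ws with
    | nil =>
      refine ⟨⟨0, w, rfl, rfl⟩, ?_⟩
      exact congrArg (true :: ·) h
    | cons w' ws =>
      obtain ⟨⟨n, u, rfl, rfl⟩, h⟩ := h
      exact ⟨⟨0, _, rfl, rfl⟩, ⟨n + 1, u, rfl, rfl⟩, ih h⟩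

theorem counting_vectors (n : ℕ) : Counting (vectors n) := by
  induction n with
  | zero => rfl
  | succ n ih => exact ih.flatMap

theorem vectors_eq_cons (n : ℕ) : ∃ ws, vectors n = List.replicate n false :: ws := by
  induction n with
  | zero => exact ⟨[], rfl⟩
  | succ n ih =>
    obtain ⟨ws, h⟩ := ih
    exact ⟨_, by rw [vectors, h]; rfl⟩

/-- Put the bits `w` on top of the columns. -/
def consBits (w : List Bool) (cs : List (List Bool)) : List (List Bool) := List.zipWith List.cons w cs

theorem consBits_replicate (b : Bool) (cs : List (List Bool)) :
    consBits (List.replicate cs.length b) cs = cs.map (b :: ·) := by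
  induction cs with
  | nil => rfl
  | cons c cs ih => simpa [consBits, List.replicate_succ] using ih

theorem consBits_append {w w' : List Bool} {cs cs' : List (List Bool)}
    (h : w.length = cs.length) : consBits (w ++ w') (cs ++ cs') = consBits w cs ++ consBits w' cs' :=
  List.zipWith_append h

theorem length_encodeColumns_consBits {w : List Bool} {cs : List (List Bool)}
    (h : w.length = cs.length) :
    (encodeColumns (consBits w cs)).length = (encodeColumns cs).length + cs.length := by
  induction cs generalizing w with
  | nil => simp [consBits, encodeColumns]
  | cons c cs ih =>
    cases w with
    | nil => simp at h
    | cons b w =>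
      have := ih (w := w) (by simpa using h)
      rw [show consBits (b :: w) (c :: cs) = (b :: c) :: consBits w cs from rfl,
        encodeColumns_cons, encodeColumns_cons]
      simp only [List.length_append, List.length_cons, List.length_map, this]
      omega

/-! ### Evaluation of quantifiers -/

def isQuantifier : Sym → Bool
  | .ex | .all => true
  | _ => false

theorem wp_eval_endSet {o : Sym} (ho : isQuantifier o) {b : Bool}
    (hQ : WP B (.endSet o (Cmd.accumulate o · b)) (WP B .eval Q)
      ⟨i, l, r, k, d, t, o :: κ, [.bit b]⟩) :
    WP B .eval Q ⟨i, l, r, k, d, t, o :: κ, [.bit b]⟩ := by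
  refine wp_eval_step (by simp) ?_
  rw [Cmd.evalStep, wp_case]
  refine wp_case.2 ?_
  cases o <;> first | exact absurd ho Bool.false_ne_true | exact hQ

/-- Loop invariant: the top bits of the columns spell the current subset `w`, `ws` are the subsets
still to come in counting order, and `u` is the value accumulated before `w`. The counter lives in
the columns themselves and costs one bit per element. -/
theorem wp_eval_sets {o : Sym} (ho : isQuantifier o) {x : List Sym}
    (hx : ∀ a ∈ x, notBit (some a) = true) {cs : List (List Bool)} {n : ℕ} {g : List Bool → Bool}
    (hg : ∀ w : List Bool, w.length = cs.length →
      Evaluates B i (encodeColumns (consBits w cs)) [] x n (g w))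
    (hr : isTick r.head? = false) (ws : List (List Bool)) {w : List Bool} {u : Bool}
    (hc : Counting (w :: ws)) (hw : ∀ w' ∈ w :: ws, w'.length = cs.length)
    (hB : (State.mk i (.bit true :: o :: l) (x ++ r) (encodeColumns cs) [] [] (o :: .bit u :: κ)
      []).size + cs.length + n + 1 ≤ B)
    (hQ : WP B .eval Q ⟨i, x.reverse ++ o :: l, r, encodeColumns cs, [], [], κ,
      [.bit ((w :: ws).foldl (fun u w => Cmd.accumulate o u (g w)) u)]⟩) :
    WP B .eval Q ⟨i, .bit true :: o :: l, x ++ r, encodeColumns (consBits w cs), [], [],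
      o :: .bit u :: κ, []⟩ := by
  simp only [State.size, List.length_append, List.length_cons, List.length_nil] at hB
  have hlen := hw w (by simp)
  have hcol := length_encodeColumns_consBits hlen
  refine hg w hlen hr (by simp) ?_ (wp_eval_endSet ho (wp_seq.2 (wp_pop.2 (wp_seq.2 (wp_pop.2
    (wp_seq.2 (wp_case.2 (wp_seq.2 (wp_pop.2 (wp_seq.2 (wp_push.2 ⟨?_, wp_push.2
      ⟨?_, wp_seq.2 ?h⟩⟩)))))))))))
  case h =>
    simp only [State.set, State.get, List.tail_cons, List.head?_cons, bitOf]
    cases ws with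
    | nil =>
      -- The last vector is all ones. The carry runs through every column and leaves zeros, which
      -- `removeVar` strips, restoring the columns as they were before the quantifier.
      rw [Counting, hlen] at hc
      rw [hc] at hQ
      rw [hc, consBits_replicate]
      rw [hc, consBits_replicate] at hcol
      rw [← List.append_nil (encodeColumns _)]
      refine wp_carry rfl ?_ (wp_case.2 (wp_seq.2 (wp_pour (by decide) ?_ (wp_seq.2 ?_))))
      · simp only [State.size, List.length_append, List.length_cons, List.length_nil,
          List.length_reverse]
        omega
      · simp only [State.size, List.length_append, List.length_cons, List.length_nil,
          List.length_reverse, length_encodeColumns_map_cons]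
        omega
      simp only [State.set, State.get, List.append_nil, List.reverse_reverse]
      refine wp_removeVar ?_ (wp_leave hx ?_ ?_)
      · simp only [State.size, List.length_append, List.length_cons, List.length_nil,
          List.length_reverse, length_encodeColumns_map_cons]
        omega
      · simp only [State.size, List.length_append, List.length_cons, List.length_nil,
          List.length_reverse]
        omega
      · simpa using hQ
    | cons w' ws =>
      obtain ⟨⟨p, y, rfl, rfl⟩, hc⟩ := hc
      -- The columns are cut at the one whose zero stops the carry. Those before it are reset, it
      -- gets a one, and those after it stay.
      obtain ⟨cs₁, c, cs₂, rfl, rfl⟩ : ∃ cs₁ c cs₂, cs = cs₁ ++ c :: cs₂ ∧ p = cs₁.length := by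
        have hp : p < cs.length := by
          rw [← hlen]
          simp
        exact ⟨cs.take p, cs[p], cs.drop (p + 1), by simp, by simp; omega⟩
      have hbits (b : Bool) : consBits (List.replicate cs₁.length b ++ (!b) :: y) (cs₁ ++ c :: cs₂) =
          cs₁.map (b :: ·) ++ ((!b) :: c) :: consBits y cs₂ := by
        rw [consBits_append (by simp), consBits_replicate]
        rfl
      have h₁ := hbits true
      have h₂ := hbits false
      rw [Bool.not_true] at h₁
      rw [Bool.not_false] at h₂
      rw [h₁] at hcol ⊢
      rw [encodeColumns_append, encodeColumns_cons, List.map_cons, List.cons_append] at hcol ⊢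
      simp only [List.length_append, List.length_cons, List.length_map,
        length_encodeColumns_map_cons] at hcol hB
      refine wp_carry rfl ?_ (wp_case.2 (wp_seq.2 (wp_pop.2 (wp_seq.2 (wp_push.2
        ⟨?_, wp_seq.2 (wp_pour (by decide) ?_ (wp_rewind hx ?_ ?h))⟩)))))
      case h =>
        simp only [State.set, State.get, List.append_nil, List.reverse_reverse, List.tail_cons]
        have := wp_eval_sets ho hx hg hr ws hc (fun w hw' => hw w (by simp [hw']))
          (u := Cmd.accumulate o u (g (List.replicate cs₁.length true ++ false :: y)))
          ?_ (by simpa using hQ)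
        · rw [h₂, encodeColumns_append, encodeColumns_cons] at this
          exact this
        · simp only [State.size, List.length_append, List.length_cons, List.length_nil] at hB ⊢
          omega
      all_goals
        simp only [State.size, State.set, State.get, List.length_append, List.length_cons,
          List.length_nil, List.length_reverse, List.length_map, List.tail_cons,
          length_encodeColumns_map_cons] at hB ⊢
        omega
  all_goals
    simp only [State.size, State.set, State.get, List.length_append, List.length_cons,
      List.length_nil, List.length_reverse, List.tail_cons, hcol]
    omega

end BAPA

/-! ### Correctness and space of the evaluator on formulas. -/

namespace BAPA

variable {B : ℕ} {Q : State → Prop} {i l r k d t κ v : List Sym}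

/-! ### Evaluation of formulas -/

/-- The values of the first `m` set variables on an element. -/
def column {N : ℕ} (ρ : ℕ → Fin N → Bool) : ℕ → Fin N → List Bool
  | 0, _ => []
  | m + 1, x => ρ m x :: column ρ m x

def columns {N : ℕ} (ρ : ℕ → Fin N → Bool) (m : ℕ) : List (List Bool) := List.ofFn (column ρ m)

theorem length_columns {N : ℕ} (ρ : ℕ → Fin N → Bool) (m : ℕ) : (columns ρ m).length = N :=
  List.length_ofFn

theorem length_column {N : ℕ} (ρ : ℕ → Fin N → Bool) (m : ℕ) (x : Fin N) :
    (column ρ m x).length = m := by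
  induction m with
  | zero => rfl
  | succ m ih => rw [column, List.length_cons, ih]

theorem getElem?_reverse_column {N : ℕ} (ρ : ℕ → Fin N → Bool) {m j : ℕ} (h : j < m)
    (x : Fin N) : (column ρ m x).reverse[j]? = some (ρ j x) := by
  induction m with
  | zero => omega
  | succ m ih =>
    rw [column, List.reverse_cons]
    rcases Nat.lt_succ_iff_lt_or_eq.1 h with h | rfl
    · rw [List.getElem?_append_left (by simpa [length_column] using h), ih h]
    · rw [List.getElem?_append_right (by simp [length_column])]
      simp [length_column]

theorem column_congr {N : ℕ} {ρ ρ' : ℕ → Fin N → Bool} {m : ℕ} (h : ∀ j < m, ρ j = ρ' j)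
    (x : Fin N) : column ρ m x = column ρ' m x := by
  induction m with
  | zero => rfl
  | succ m ih => rw [column, column, h m (by omega), ih fun j hj => h j (by omega)]

theorem SetTerm.onColumn_column {N m : ℕ} (a : SetTerm (Fin m)) (ρ : ℕ → Fin N → Bool)
    (x : Fin N) : a.onColumn (column ρ m x) = a.contains fun j : Fin _ => ρ j x := by
  rw [SetTerm.onColumn]
  congr 1
  funext j
  rw [getElem?_reverse_column ρ j.2]
  rfl

/-- The set with the bit vector `w`. -/
def bitSet (N : ℕ) (w : List Bool) (x : Fin N) : Bool := w[(x : ℕ)]?.getD false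

theorem bitSet_ofFn {N : ℕ} (X : Fin N → Bool) : bitSet N (List.ofFn X) = X := by
  funext x
  simp [bitSet]

/-- Links the counter to the semantics: new top bits are the characteristic vector of the value of
the next set variable. -/
theorem consBits_columns {N m : ℕ} (ρ : ℕ → Fin N → Bool) {w : List Bool} (h : w.length = N) :
    consBits w (columns ρ m) = columns (Function.update ρ m (bitSet N w)) (m + 1) := by
  subst h
  refine List.ext_getElem (by simp [consBits, columns]) fun j h1 h2 => ?_
  have hj : j < w.length := by simpa [columns] using h2
  have := column_congr (ρ := Function.update ρ m (bitSet w.length w)) (ρ' := ρ)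
    (fun j hj => Function.update_of_ne hj.ne _ _) ⟨j, hj⟩
  simp [consBits, columns, column, this, bitSet]

theorem foldl_or {α : Type} (g : α → Bool) (u : Bool) (ws : List α) :
    ws.foldl (fun u w => Cmd.accumulate .ex u (g w)) u = (u || ws.any g) := by
  induction ws generalizing u with
  | nil => simp
  | cons w ws ih => rw [List.foldl_cons, ih, List.any_cons, Cmd.accumulate, Bool.or_assoc]

theorem foldl_and {α : Type} (g : α → Bool) (u : Bool) (ws : List α) :
    ws.foldl (fun u w => Cmd.accumulate .all u (g w)) u = (u && ws.all g) := by
  induction ws generalizing u with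
  | nil => simp
  | cons w ws ih => rw [List.foldl_cons, ih, List.all_cons, Cmd.accumulate, Bool.and_assoc]; simp

theorem Evaluates.atom {N m : ℕ} (ρ : ℕ → Fin N → Bool) {o : Sym} (ho : isAtomic o)
    (a b : SetTerm (Fin m)) {u : Bool}
    (hu : u = true ↔ ∀ x, Cmd.binary o (a.contains fun j : Fin _ => ρ j x) (b.contains fun j : Fin _ => ρ j x)) :
    Evaluates B i (encodeColumns (columns ρ m)) [] (o :: (a.encode ++ b.encode))
      (3 * (a.size + b.size) + 5) u := by
  intro Q l r κ hr hκ hB hQ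
  simp only [State.size, List.length_append, List.length_cons, List.length_nil] at hB
  have hu' : u = (columns ρ m).all fun c => Cmd.binary o (a.onColumn c) (b.onColumn c) := by
    rw [Bool.eq_iff_iff, hu]
    simp [columns, SetTerm.onColumn_column]
  have h : WP B (.enter o true) (WP B .eval Q)
      ⟨i, l, o :: (a.encode ++ b.encode ++ r), encodeColumns (columns ρ m), [], [], κ, []⟩ := by
    refine wp_enter ?_ (wp_eval_elements ho a b hr (columns ρ m) (done := []) ?_ ?_)
    · simp only [State.size, List.length_append, List.length_cons, List.length_nil]
      omega
    · simp only [State.size, List.length_append, List.length_cons, List.length_nil,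
        encodeColumns_nil, List.reverse_nil]
      omega
    · simpa [← hu'] using hQ
  rw [List.cons_append]
  refine wp_eval_step hκ ?_
  rw [Cmd.evalStep, wp_case]
  refine wp_case.2 ?_
  cases o <;> first | exact absurd ho Bool.false_ne_true | exact h

/-- Of the extra cells, `N` hold the new bits, three hold the mark, the symbol and the accumulated
value, and one is for working. -/
theorem Evaluates.quantifier {N m : ℕ} (ρ : ℕ → Fin N → Bool) {o : Sym} (ho : isQuantifier o)
    {x : List Sym} (hx : ∀ a ∈ x, notBit (some a) = true) {n : ℕ} {g : (Fin N → Bool) → Bool}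
    (hg : ∀ X, Evaluates B i (encodeColumns (columns (Function.update ρ m X) (m + 1))) [] x n (g X))
    {u : Bool}
    (hu : u = (vectors N).foldl (fun u w => Cmd.accumulate o u (g (bitSet N w)))
      (match o with
        | .ex => false
        | _ => true)) :
    Evaluates B i (encodeColumns (columns ρ m)) [] (o :: x) (n + N + 4) u := by
  intro Q l r κ hr hκ hB hQ
  simp only [State.size, List.length_append, List.length_cons, List.length_nil] at hB
  obtain ⟨ws, hws⟩ := vectors_eq_cons N
  have hlen := length_columns ρ m
  have h (b : Bool) (hb : u = (vectors N).foldl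
      (fun u w => Cmd.accumulate o u (g (bitSet N w))) b) :
      WP B (.seq (.enter o b) .addVar) (WP B .eval Q)
        ⟨i, l, o :: (x ++ r), encodeColumns (columns ρ m), [], [], κ, []⟩ := by
    refine wp_seq.2 (wp_enter ?_ (wp_addVar ?_ ?_))
    · simp only [State.size, List.length_append, List.length_cons, List.length_nil]
      omega
    · simp only [State.size, List.length_append, List.length_cons, List.length_nil]
      omega
    rw [← consBits_replicate]
    refine wp_eval_sets ho hx (g := fun w => g (bitSet N w)) (n := n) (fun w hw => ?_) hr ws
      ?_ (fun w hw => ?_) ?_ ?_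
    · rw [consBits_columns ρ (hw.trans hlen)]
      exact hg _
    · rw [hlen, ← hws]
      exact counting_vectors N
    · rw [hlen, ← hws] at hw
      rw [mem_vectors.1 hw, hlen]
    · simp only [State.size, List.length_append, List.length_cons, List.length_nil]
      omega
    · rw [hlen, ← hws, ← hb]
      simpa using hQ
  rw [List.cons_append]
  refine wp_eval_step hκ ?_
  rw [Cmd.evalStep, wp_case]
  refine wp_case.2 ?_
  cases o <;> first | exact absurd ho Bool.false_ne_true | exact h _ hu

/-- Each set quantifier is charged one bit per element and each symbol a constant. Allowances of
subformulas are added even where the space is reused. -/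
theorem BAFormula.evaluates {N m : ℕ} (F : BAFormula m) (ρ : ℕ → Fin N → Bool) {u : Bool}
    (hu : u = true ↔ F.Sat ρ) :
    Evaluates B i (encodeColumns (columns ρ m)) [] F.encode (5 * F.size + N * F.numVars) u := by
  classical
  induction F generalizing u ρ with
  | eq a b =>
    refine (Evaluates.atom ρ (o := .eq) rfl a b (hu.trans ?_)).mono ?_
    · simp [BAFormula.Sat, Cmd.binary]
    · simp only [BAFormula.size]
      omega
  | subset a b =>
    refine (Evaluates.atom ρ (o := .subset) rfl a b (hu.trans ?_)).mono ?_
    · simp only [BAFormula.Sat, Cmd.binary]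
      refine forall_congr' fun x => ?_
      cases a.contains fun j : Fin _ => ρ j x <;> simp
    · simp only [BAFormula.size]
      omega
  | and F G ihF ihG =>
    obtain rfl : u = Cmd.binary .and (decide (F.Sat ρ)) (decide (G.Sat ρ)) := by
      rw [Bool.eq_iff_iff, hu]
      simp [Cmd.binary, BAFormula.Sat]
    refine ((ihF ρ (by simp)).binary rfl (ihG ρ (by simp)) G.isTick_head_encode).mono ?_
    simp only [BAFormula.size, BAFormula.numVars, Nat.mul_add]
    omega
  | or F G ihF ihG =>
    obtain rfl : u = Cmd.binary .or (decide (F.Sat ρ)) (decide (G.Sat ρ)) := by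
      rw [Bool.eq_iff_iff, hu]
      simp [Cmd.binary, BAFormula.Sat]
    refine ((ihF ρ (by simp)).binary rfl (ihG ρ (by simp)) G.isTick_head_encode).mono ?_
    simp only [BAFormula.size, BAFormula.numVars, Nat.mul_add]
    omega
  | not F ih =>
    obtain rfl : u = !decide (F.Sat ρ) := by
      rw [Bool.eq_iff_iff, hu]
      simp [BAFormula.Sat]
    refine ((ih ρ (by simp)).unary rfl).mono ?_
    simp only [BAFormula.size, BAFormula.numVars]
    omega
  | @ex m F ih =>
    refine (Evaluates.quantifier ρ (o := .ex) rfl F.notBit_of_mem_encode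
      (g := fun X => decide (F.Sat (Function.update ρ m X))) (fun X => ih _ (by simp)) ?_).mono ?_
    · rw [foldl_or, Bool.eq_iff_iff, hu]
      simp only [BAFormula.Sat, Bool.false_or, List.any_eq_true, mem_vectors, decide_eq_true_eq]
      exact ⟨fun ⟨X, h⟩ => ⟨List.ofFn X, List.length_ofFn, by rwa [bitSet_ofFn]⟩,
        fun ⟨w, _, h⟩ => ⟨_, h⟩⟩
    · simp only [BAFormula.size, BAFormula.numVars, Nat.mul_add]
      omega
  | @all m F ih =>
    refine (Evaluates.quantifier ρ (o := .all) rfl F.notBit_of_mem_encode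
      (g := fun X => decide (F.Sat (Function.update ρ m X))) (fun X => ih _ (by simp)) ?_).mono ?_
    · rw [foldl_and, Bool.eq_iff_iff, hu]
      simp only [BAFormula.Sat, Bool.true_and, List.all_eq_true, mem_vectors, decide_eq_true_eq]
      exact ⟨fun h w _ => h _, fun h X => by
        simpa only [bitSet_ofFn] using h (List.ofFn X) List.length_ofFn⟩
    · simp only [BAFormula.size, BAFormula.numVars, Nat.mul_add]
      omega

end BAPA

/-! ### The two decision programs and their space bounds. -/

namespace BAPA

variable {B : ℕ} {Q : State → Prop} {i l r k d t κ v : List Sym}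

/-! ### The two machines -/

/-- With no set variable in scope, only the terminators of the columns remain: the universe is its
cardinality in unary. -/
theorem encodeColumns_columns_zero {N : ℕ} (ρ : ℕ → Fin N → Bool) :
    encodeColumns (columns ρ 0) = List.replicate N .tick := by
  rw [columns, show column ρ 0 = fun _ => [] from rfl, List.ofFn_const]
  induction N with
  | zero => rfl
  | succ N ih =>
    rw [List.replicate_succ, encodeColumns_cons, List.replicate_succ]
    exact congrArg (Sym.tick :: ·) (ih fun _ _ => false)

theorem wp_eval_sentence {F : BAFormula 0} {N : ℕ} {u : Bool}
    (hu : u = true ↔ (alpha F).TrueAt N)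
    (hB : i.length + F.encode.length + N + 1 + (5 * F.size + N * F.numVars) ≤ B)
    (hQ : Q ⟨i, F.encode.reverse, [], List.replicate N .tick, [], [], [], [.bit u]⟩) :
    WP B .eval Q ⟨i, [], F.encode, List.replicate N .tick, [], [], [.tick], []⟩ := by
  let ρ : ℕ → Fin N → Bool := fun _ _ => false
  have hs : u = true ↔ F.Sat ρ := by
    rw [hu, ← trueAt_alpha_iff_sat F ρ, Fintype.card_fin]
  have h := F.evaluates (B := B) (i := i) ρ hs (Q := Q) (l := []) (r := []) (κ := [.tick]) rfl
    (by simp)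
  rw [encodeColumns_columns_zero, List.append_nil, List.append_nil] at h
  refine h ?_ (wp_eval_step (by simp) (wp_case.2 (wp_case.2 (wp_pop.2 (wp_stop rfl hQ)))))
  simp only [State.size, List.length_nil, List.length_replicate, List.length_cons]
  omega

namespace Cmd

/-- Double the number of symbols on `col`. -/
def double : Cmd :=
  seq (loop .col Option.isSome (seq (pop .col) (seq (push .don .tick) (push .don .tick))))
    (pour .don .col)

/-- Read the formula, doubling the number of symbols on `col` for each set variable. -/
def prepare : Cmd :=
  seq (push .col .tick) <|
    seq (loop .inp notBit
      (seq (case .inp fun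
        | some .ex | some .all => double
        | _ => skip) (move .inp .lft)))
    (pour .lft .rgt)

/-- Decide the truth of the formula on `rgt` for all universes with at most as many elements as
there are symbols on `col`. -/
def allSizes : Cmd :=
  loop .val Option.isNone <| seq (push .ctl .tick) <| seq eval <| seq (pour .lft .rgt) <|
    case .val fun
      | some (.bit true) =>
          case .col fun
            | some _ => seq (pop .col) (pop .val)
            | none => skip
      | _ => skip

/-- The program of the first machine. -/
def decideAll : Cmd := seq prepare (seq allSizes (seq (clear .rgt) (clear .col)))

/-- Decrease the binary number on `inp`; if it was positive, put a symbol on `col`. -/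
def decrement : Cmd :=
  seq (loop .inp (fun o => isBit o && !bitOf o) (seq (pop .inp) (push .tmp (.bit true)))) <|
    case .inp fun
      | some _ => seq (pop .inp) <| seq (push .inp (.bit false)) <|
          seq (push .col .tick) (pour .tmp .inp)
      | none => clear .tmp

/-- The program of the second machine. -/
def decideAt : Cmd :=
  seq prepare <| seq (pour .col .don) <| seq (loop .don Option.isSome (seq (pop .don) decrement)) <|
    seq (clear .inp) <| seq (push .ctl .tick) <| seq eval <| seq (clear .lft) (clear .col)

end Cmd

theorem wp_double {n : ℕ}
    (hB : (State.mk i l r (List.replicate n .tick) [] t κ v).size + n ≤ B)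
    (hQ : Q ⟨i, l, r, List.replicate (2 * n) .tick, [], t, κ, v⟩) :
    WP B .double Q ⟨i, l, r, List.replicate n .tick, [], t, κ, v⟩ := by
  simp only [State.size, List.length_replicate, List.length_nil] at hB
  have key : ∀ m p, p + 2 * m = 2 * n →
      WP B (.loop .col Option.isSome (.seq (.pop .col) (.seq (.push .don .tick) (.push .don .tick))))
        (WP B (.pour .don .col) Q)
        ⟨i, l, r, List.replicate m .tick, List.replicate p .tick, t, κ, v⟩ := by
    intro m
    induction m with
    | zero =>
      intro p hp
      refine wp_stop rfl (wp_pour (by decide) ?_ ?_)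
      · simp only [State.size, List.length_replicate]
        omega
      · rw [show p = 2 * n by omega]
        simpa [State.set, State.get] using hQ
    | succ m ih =>
      intro p hp
      refine wp_step rfl (wp_seq.2 (wp_pop.2 (wp_seq.2 (wp_push.2 ⟨?_, wp_push.2
        ⟨?_, ih (p + 2) (by omega)⟩⟩))))
      all_goals
        simp only [State.size, State.set, State.get, List.length_replicate, List.length_cons,
          List.length_tail]
        omega
  exact wp_seq.2 (key n 0 (by omega))

/-- Every quantifier symbol doubles the contents of `col`, so `n * 2 ^ (quantifiers still to read)`
is invariant. The formula ends at the first bit or at the end of the input. -/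
theorem wp_prepare {x y : List Sym} (hx : ∀ a ∈ x, notBit (some a) = true)
    (hy : notBit y.head? = false) (hB : x.length + y.length + 2 ^ x.countP isQuantifier ≤ B)
    (hQ : Q ⟨y, [], x, List.replicate (2 ^ x.countP isQuantifier) .tick, [], [], [], []⟩) :
    WP B .prepare Q (State.ofInp (x ++ y) []) := by
  have key : ∀ x l n, (∀ a ∈ x, notBit (some a) = true) →
      l.length + x.length + y.length + n * 2 ^ x.countP isQuantifier ≤ B →
      WP B (.pour .lft .rgt) Q ⟨y, x.reverse ++ l, [],
        List.replicate (n * 2 ^ x.countP isQuantifier) .tick, [], [], [], []⟩ →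
      WP B (.loop .inp notBit (.seq (.case .inp fun
        | some .ex | some .all => .double
        | _ => .skip) (.move .inp .lft))) (WP B (.pour .lft .rgt) Q)
        ⟨x ++ y, l, [], List.replicate n .tick, [], [], [], []⟩ := by
    intro x
    induction x with
    | nil =>
      intro l n _ _ h
      refine wp_stop hy ?_
      simpa using h
    | cons a x ih =>
      intro l n hx hB h
      refine wp_step (hx a (by simp)) (wp_seq.2 (wp_case.2 ?_))
      have hpow : 1 ≤ 2 ^ x.countP isQuantifier := Nat.one_le_two_pow
      have hn : n ≤ n * 2 ^ x.countP isQuantifier := Nat.le_mul_of_pos_right _ hpow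
      have hmove (m : ℕ) (hm : m * 2 ^ x.countP isQuantifier =
          n * 2 ^ (a :: x).countP isQuantifier) : WP B (.move .inp .lft)
          (WP B (.loop .inp notBit (.seq (.case .inp fun
            | some .ex | some .all => .double
            | _ => .skip) (.move .inp .lft))) (WP B (.pour .lft .rgt) Q))
          ⟨a :: (x ++ y), l, [], List.replicate m .tick, [], [], [], []⟩ := by
        have hm' : m ≤ m * 2 ^ x.countP isQuantifier := Nat.le_mul_of_pos_right _ hpow
        refine wp_move (by decide) rfl ?_ (ih _ m (fun b hb => hx b (by simp [hb])) ?_ ?_)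
        · simp only [State.size, List.length_cons, List.length_append, List.length_replicate,
            List.length_nil] at hB ⊢
          omega
        · simp only [State.get, List.length_cons] at hB ⊢
          omega
        · rw [hm]
          simpa [State.get] using h
      have hskip (ha : isQuantifier a = false) : n * 2 ^ x.countP isQuantifier =
          n * 2 ^ (a :: x).countP isQuantifier := by
        rw [List.countP_cons_of_neg (by simp [ha])]
      have hdouble (ha : isQuantifier a = true) : WP B .double (WP B (.move .inp .lft)
          (WP B (.loop .inp notBit (.seq (.case .inp fun
            | some .ex | some .all => .double
            | _ => .skip) (.move .inp .lft))) (WP B (.pour .lft .rgt) Q)))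
          ⟨a :: (x ++ y), l, [], List.replicate n .tick, [], [], [], []⟩ := by
        have h2 : 2 * n * 2 ^ x.countP isQuantifier = n * 2 ^ (a :: x).countP isQuantifier := by
          rw [List.countP_cons_of_pos ha, pow_succ]
          ring
        refine wp_double ?_ (hmove (2 * n) h2)
        have h3 : 2 * n * 1 ≤ 2 * n * 2 ^ x.countP isQuantifier := Nat.mul_le_mul_left _ hpow
        simp only [State.size, List.length_cons, List.length_append, List.length_replicate,
          List.length_nil] at hB ⊢
        omega
      cases a <;> first | exact hdouble rfl | exact wp_skip.2 (hmove n (hskip rfl))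
  have h1 : 1 ≤ 2 ^ x.countP isQuantifier := Nat.one_le_two_pow
  refine wp_seq.2 (wp_push.2 ⟨?_, wp_seq.2 (key x [] 1 hx ?_ (wp_pour (by decide) ?_ ?_))⟩)
  · simp only [State.size, State.set, State.get, State.ofInp, List.length_append, List.length_cons,
      List.length_nil]
    omega
  · simp only [List.length_nil]
    omega
  · simp only [State.size, List.length_append, List.length_reverse, List.length_replicate,
      List.length_nil]
    omega
  · simpa [State.set, State.get] using hQ

/-- Sizes are tried downwards until one fails or 0 has been tested. The number of symbols left on
`col` depends on where this happens, hence the quantifier in `hQ`. -/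
theorem wp_allSizes {F : BAFormula 0} (N : ℕ) {u : Bool}
    (hu : u = true ↔ ∀ n ≤ N, (alpha F).TrueAt n)
    (hB : F.encode.length + N + 1 + (5 * F.size + N * F.numVars) ≤ B)
    (hQ : ∀ n, Q ⟨[], [], F.encode, List.replicate n .tick, [], [], [], [.bit u]⟩) :
    WP B .allSizes Q ⟨[], [], F.encode, List.replicate N .tick, [], [], [], []⟩ := by
  classical
  induction N generalizing u with
  | zero =>
    refine wp_step rfl (wp_seq.2 (wp_push.2 ⟨?_, wp_seq.2 (wp_eval_sentence (u := u)
      (by simp [hu]) ?_ (wp_seq.2 (wp_pour (by decide) ?_ (wp_case.2 ?_))))⟩))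
    case refine_4 =>
      have h : Q ⟨[], [], F.encode, [], [], [], [], [.bit u]⟩ := hQ 0
      simp only [State.set, State.get, List.reverse_reverse, List.append_nil]
      cases u
      · exact wp_skip.2 (wp_stop rfl h)
      · exact wp_case.2 (wp_skip.2 (wp_stop rfl h))
    all_goals
      simp only [State.size, State.set, State.get, List.length_replicate, List.length_cons,
        List.length_nil, List.length_reverse]
      omega
  | succ N ih =>
    refine wp_step rfl (wp_seq.2 (wp_push.2 ⟨?_, wp_seq.2 (wp_eval_sentence
      (u := decide ((alpha F).TrueAt (N + 1)))
      (by simp) ?_ (wp_seq.2 (wp_pour (by decide) ?_ (wp_case.2 ?_))))⟩))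
    case refine_4 =>
      simp only [State.set, State.get, List.reverse_reverse, List.append_nil]
      by_cases h : (alpha F).TrueAt (N + 1)
      · rw [decide_eq_true h]
        refine wp_case.2 (wp_seq.2 (wp_pop.2 (wp_pop.2 (ih (hu.trans ?_) ?_ hQ))))
        · exact ⟨fun h' n hn => h' n (by omega), fun h' n hn =>
            (Nat.le_succ_iff.1 hn).elim (h' n) fun e => e ▸ h⟩
        · rw [Nat.add_mul] at hB
          omega
      · rw [decide_eq_false h]
        obtain rfl : u = false := by
          rw [← Bool.not_eq_true, hu]
          exact fun h' => h (h' _ le_rfl)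
        exact wp_skip.2 (wp_stop rfl (hQ (N + 1)))
    all_goals
      simp only [State.size, State.set, State.get, List.length_replicate, List.length_cons,
        List.length_nil, List.length_reverse]
      omega

/-- The number with the binary digits `w`, least significant digit first. -/
def ofBinary : List Bool → ℕ
  | [] => 0
  | b :: w => b.toNat + 2 * ofBinary w

theorem ofBinary_bits (N : ℕ) : ofBinary N.bits = N := by
  induction N using Nat.binaryRec' with
  | zero => simp [ofBinary]
  | bit b n h ih =>
    rw [Nat.bits_append_bit n b h, ofBinary, ih, Nat.bit_val]
    omega

/-- Binary decrement: low zeros become ones and the first one becomes zero, unless there are only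
zeros. -/
theorem binary_cases (w : List Bool) :
    (w = List.replicate w.length false ∧ ofBinary w = 0) ∨
      ∃ n u, w = List.replicate n false ++ true :: u ∧
        ofBinary (List.replicate n true ++ false :: u) + 1 = ofBinary w := by
  induction w with
  | nil => exact .inl ⟨rfl, rfl⟩
  | cons b w ih =>
    cases b
    · rcases ih with ⟨h, h0⟩ | ⟨n, u, h, h1⟩
      · exact .inl ⟨congrArg (false :: ·) h, by rw [ofBinary, h0]; rfl⟩
      · refine .inr ⟨n + 1, u, congrArg (false :: ·) h, ?_⟩
        rw [List.replicate_succ, List.cons_append, ofBinary, ofBinary, Bool.toNat_true,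
          Bool.toNat_false]
        omega
    · refine .inr ⟨0, w, rfl, ?_⟩
      simp only [List.replicate_zero, List.nil_append, ofBinary, Bool.toNat_true, Bool.toNat_false]
      omega

theorem wp_skipZeros {n : ℕ} (hk : (isBit k.head? && !bitOf k.head?) = false)
    (hB : (State.mk ((List.replicate n false).map .bit ++ k) l r d i t κ v).size ≤ B)
    (hQ : Q ⟨k, l, r, d, i, (List.replicate n true).map .bit ++ t, κ, v⟩) :
    WP B (.loop .inp (fun o => isBit o && !bitOf o) (.seq (.pop .inp) (.push .tmp (.bit true)))) Q
      ⟨(List.replicate n false).map .bit ++ k, l, r, d, i, t, κ, v⟩ := by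
  induction n generalizing t with
  | zero => exact wp_stop hk hQ
  | succ n ih =>
    simp only [State.size, List.length_append, List.length_map, List.length_replicate] at hB
    refine wp_step rfl (wp_seq.2 (wp_pop.2 (wp_push.2 ⟨?_, ih ?_ ?_⟩)))
    · simp only [State.size, State.set, State.get, List.length_append, List.length_map,
        List.length_replicate, List.length_tail, List.length_cons]
      omega
    · simp only [State.size, State.set, State.get, List.length_append, List.length_map,
        List.length_replicate, List.length_cons]
      omega
    · simpa [State.set, State.get, List.replicate_succ'] using hQ

theorem wp_decrement {w : List Bool} {n : ℕ}
    (hB : (State.mk (w.map .bit) l r (List.replicate n .tick) d [] κ v).size + 1 ≤ B)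
    (h0 : ofBinary w = 0 → Q ⟨[], l, r, List.replicate n .tick, d, [], κ, v⟩)
    (h1 : ∀ w', w'.length = w.length → ofBinary w' + 1 = ofBinary w →
      Q ⟨w'.map .bit, l, r, List.replicate (n + 1) .tick, d, [], κ, v⟩) :
    WP B .decrement Q ⟨w.map .bit, l, r, List.replicate n .tick, d, [], κ, v⟩ := by
  simp only [State.size, List.length_map, List.length_replicate, List.length_nil] at hB
  rcases binary_cases w with ⟨h, hw⟩ | ⟨m, u, rfl, hw⟩
  · rw [h, ← List.append_nil (List.map _ _)]
    refine wp_seq.2 (wp_skipZeros rfl ?_ (wp_case.2 (wp_clear (h0 hw))))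
    simp only [State.size, List.length_append, List.length_map, List.length_replicate,
      List.length_nil]
    omega
  · have h := h1 _ (by simp) hw
    simp only [List.length_append, List.length_replicate, List.length_cons] at hB
    rw [List.map_append]
    refine wp_seq.2 (wp_skipZeros rfl ?_ (wp_case.2 (wp_seq.2 (wp_pop.2 (wp_seq.2 (wp_push.2
      ⟨?_, wp_seq.2 (wp_push.2 ⟨?_, wp_pour (by decide) ?_ ?h⟩)⟩))))))
    case h => simpa [State.set, State.get, List.replicate_succ, ← List.map_reverse] using h
    all_goals
      simp only [State.size, State.set, State.get, List.length_append, List.length_map,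
        List.length_replicate, List.length_nil, List.length_cons, List.tail_cons, List.map_cons]
      omega

/-- Each of the `m` symbols on `don` pays for one decrement, and only a decrement of a positive
number leaves a symbol on `col`. The cell freed on `don` is the spare one that `wp_decrement`
requires. -/
theorem wp_minimum (m : ℕ) {w : List Bool} {n : ℕ}
    (hB : (State.mk (w.map .bit) l r (List.replicate n .tick) (List.replicate m .tick) [] κ v).size
      ≤ B)
    (hQ : ∀ i, Q ⟨i, l, r, List.replicate (n + min (ofBinary w) m) .tick, [], [], κ, v⟩) :
    WP B (.loop .don Option.isSome (.seq (.pop .don) .decrement)) Q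
      ⟨w.map .bit, l, r, List.replicate n .tick, List.replicate m .tick, [], κ, v⟩ := by
  induction m generalizing w n with
  | zero => exact wp_stop rfl (by simpa using hQ (w.map .bit))
  | succ m ih =>
    simp only [State.size, List.length_map, List.length_replicate, List.length_nil] at hB
    refine wp_step rfl (wp_seq.2 (wp_pop.2 (wp_decrement (d := List.replicate m .tick) ?_
      (fun h => ?_) fun w' hl h => ?_)))
    · simp only [State.size, List.length_map, List.length_replicate,
        List.length_nil]
      omega
    -- Decrementing zero empties `inp`; the empty word again denotes zero, so the remaining rounds
    -- change nothing on `col`.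
    · refine ih (w := []) ?_ fun i => ?_
      · simp only [State.size, List.length_map, List.length_replicate, List.length_nil]
        omega
      · simpa [h, ofBinary] using hQ i
    · refine ih ?_ fun i => ?_
      · simp only [State.size, List.length_map, List.length_replicate, List.length_nil]
        omega
      · have := hQ i
        rw [show n + min (ofBinary w) (m + 1) = n + 1 + min (ofBinary w') m by omega] at this
        exact this

theorem SetTerm.countP_encode {m : ℕ} (a : SetTerm (Fin m)) : a.encode.countP isQuantifier = 0 := by
  induction a with
  | var x => simp [SetTerm.encode, isQuantifier, List.countP_replicate]
  | empty | univ => rfl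
  | union a b iha ihb | inter a b iha ihb =>
    simp [SetTerm.encode, isQuantifier, iha, ihb]
  | compl a iha => simp [SetTerm.encode, isQuantifier, iha]

theorem BAFormula.countP_encode {m : ℕ} (F : BAFormula m) :
    F.encode.countP isQuantifier = F.numVars := by
  induction F with
  | eq a b | subset a b =>
    simp [BAFormula.encode, BAFormula.numVars, isQuantifier,
      SetTerm.countP_encode]
  | _ => simp_all [BAFormula.encode, BAFormula.numVars, isQuantifier, List.countP_cons]

theorem SetTerm.length_encode_le {m K : ℕ} (a : SetTerm (Fin m)) (hm : m ≤ K) (hK : 1 ≤ K) :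
    a.encode.length ≤ a.size * K := by
  induction a with
  | var x =>
    have := x.2
    simp only [SetTerm.encode, SetTerm.size, List.length_cons, List.length_replicate]
    omega
  | empty | univ => simpa [SetTerm.encode, SetTerm.size] using hK
  | union a b iha ihb | inter a b iha ihb =>
    simp only [SetTerm.encode, SetTerm.size, List.length_cons, List.length_append, Nat.add_mul]
    omega
  | compl a iha =>
    simp only [SetTerm.encode, SetTerm.size, List.length_cons, Nat.add_mul]
    omega

/-- A variable is named by its depth, so an occurrence in unary takes at most as many symbols as
there are variables. This is one source of the factor `S` in the bound. -/
theorem BAFormula.length_encode_le {m K : ℕ} (F : BAFormula m) (hm : m + F.numVars ≤ K)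
    (hK : 1 ≤ K) : F.encode.length ≤ F.size * K := by
  induction F with
  | eq a b | subset a b =>
    have ha := a.length_encode_le (K := K) (by omega) hK
    have hb := b.length_encode_le (K := K) (by omega) hK
    simp only [BAFormula.encode, BAFormula.size, List.length_cons, List.length_append, Nat.add_mul]
    omega
  | and F G ihF ihG | or F G ihF ihG =>
    simp only [BAFormula.numVars] at hm
    have hF := ihF (by omega)
    have hG := ihG (by omega)
    simp only [BAFormula.encode, BAFormula.size, List.length_cons, List.length_append, Nat.add_mul]
    omega
  | not F ih | ex F ih | all F ih =>
    simp only [BAFormula.numVars] at hm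
    have hF := ih (by omega)
    simp only [BAFormula.encode, BAFormula.size, List.length_cons, Nat.add_mul]
    omega

theorem BAFormula.one_le_size {m : ℕ} (F : BAFormula m) : 1 ≤ F.size := by
  cases F <;> simp [BAFormula.size]

theorem BAFormula.numVars_le_size {m : ℕ} (F : BAFormula m) : F.numVars ≤ F.size := by
  induction F <;> simp only [BAFormula.numVars, BAFormula.size] <;> omega

/-- The measure of the space bounds. -/
def BAFormula.measure (F : BAFormula 0) : ℕ := F.size * max F.numVars 1 * 2 ^ F.numVars

/-- The summands are at most 1, 1, 1, 5, 1 and 1 times the measure, so 12 leaves some slack. -/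
theorem BAFormula.encode_add_le_measure (F : BAFormula 0) {N : ℕ} (hN : N ≤ 2 ^ F.numVars) :
    F.encode.length + N + 1 + (5 * F.size + N * F.numVars) + 2 ^ F.numVars ≤ 12 * F.measure := by
  have hK : 1 ≤ max F.numVars 1 := le_max_right _ _
  have h1 := F.length_encode_le (K := max F.numVars 1) (by omega) hK
  have hp : 1 ≤ 2 ^ F.numVars := Nat.one_le_two_pow
  have hs := F.one_le_size
  have h2 : F.size * max F.numVars 1 ≤ F.measure := Nat.le_mul_of_pos_right _ hp
  have h3 : F.size ≤ F.size * max F.numVars 1 := Nat.le_mul_of_pos_right _ hK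
  have h4 : 2 ^ F.numVars ≤ F.measure := Nat.le_mul_of_pos_left _ (Nat.mul_pos hs hK)
  have h5 : N * F.numVars ≤ F.measure := by
    rw [BAFormula.measure, mul_comm]
    refine Nat.mul_le_mul ?_ hN
    calc F.numVars ≤ 1 * max F.numVars 1 := by omega
      _ ≤ _ := Nat.mul_le_mul_right _ hs
  omega

/-- Each factor of the measure is at most `2 ^ n`, using `S ≤ n`, and `12 ≤ 2 ^ (4 * n)`. -/
theorem BAFormula.measure_le_two_pow (F : BAFormula 0) : 12 * F.measure ≤ 2 ^ (12 * F.size) := by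
  have hs := F.one_le_size
  have hv := F.numVars_le_size
  have h1 : F.size ≤ 2 ^ F.size := Nat.lt_two_pow_self.le
  have h2 : max F.numVars 1 ≤ 2 ^ F.size := by omega
  have h3 : 2 ^ F.numVars ≤ 2 ^ F.size := Nat.pow_le_pow_right (by norm_num) hv
  have h4 : 12 ≤ 2 ^ (4 * F.size) :=
    (by norm_num : 12 ≤ 2 ^ (4 * 1)).trans (Nat.pow_le_pow_right (by norm_num) (by omega))
  calc 12 * F.measure ≤ 2 ^ (4 * F.size) * (2 ^ F.size * 2 ^ F.size * 2 ^ F.size) :=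
        Nat.mul_le_mul h4 (Nat.mul_le_mul (Nat.mul_le_mul h1 h2) h3)
    _ = 2 ^ (7 * F.size) := by
        rw [← pow_add, ← pow_add, ← pow_add]
        congr 1
        ring
    _ ≤ 2 ^ (12 * F.size) := Nat.pow_le_pow_right (by norm_num) (by omega)

theorem run_decideAll (F : BAFormula 0) {u : Bool} (hu : u = true ↔ ∀ N, (alpha F).TrueAt N) :
    Run (12 * F.measure) .decideAll (State.ofInp F.encode []) (State.ofInp [] [.bit u]) := by
  have hp : 1 ≤ 2 ^ F.numVars := Nat.one_le_two_pow
  have hB := F.encode_add_le_measure le_rfl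
  have h : WP (12 * F.measure) .decideAll (· = State.ofInp [] [.bit u])
      (State.ofInp (F.encode ++ []) []) := by
    refine wp_seq.2 (wp_prepare F.notBit_of_mem_encode rfl ?_ (wp_seq.2 (wp_allSizes _ (u := u)
      (hu.trans ⟨fun h n _ => h n, fun h n => ?_⟩) ?_
      fun n => wp_seq.2 (wp_clear (wp_clear rfl)))))
    · rw [F.countP_encode, List.length_nil]
      omega
    · rw [F.countP_encode] at h
      -- By capping, truth for all sizes up to `2 ^ S` is truth for all sizes.
      exact (trueAt_alpha_min F n).2 (h _ (min_le_right _ _))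
    · rw [F.countP_encode]
      omega
  rw [List.append_nil] at h
  obtain ⟨_, h, rfl⟩ := h
  exact h

theorem run_decideAt (F : BAFormula 0) (N : ℕ) {u : Bool}
    (hu : u = true ↔ (alpha F).TrueAt N) :
    Run (12 * F.measure + N.size) .decideAt (State.ofInp (F.encode ++ encodeNat N) [])
      (State.ofInp [] [.bit u]) := by
  have hp : 1 ≤ 2 ^ F.numVars := Nat.one_le_two_pow
  have hB := F.encode_add_le_measure (min_le_right N (2 ^ F.numVars))
  have hlen : (encodeNat N).length = N.size := by
    rw [encodeNat, List.length_map, Nat.size_eq_bits_len]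
  have hm : min N (2 ^ F.numVars) ≤ 2 ^ F.numVars := min_le_right _ _
  have h : WP (12 * F.measure + N.size) .decideAt (· = State.ofInp [] [.bit u])
      (State.ofInp (F.encode ++ encodeNat N) []) := by
    refine wp_seq.2 (wp_prepare F.notBit_of_mem_encode ?_ ?_ (wp_seq.2 (wp_pour (by decide) ?_
      (wp_seq.2 ?_))))
    · rw [encodeNat]
      cases N.bits <;> rfl
    · rw [F.countP_encode]
      omega
    · simp only [State.size, List.length_replicate, List.length_nil, F.countP_encode]
      omega
    simp only [State.set, State.get, List.append_nil, List.reverse_replicate, F.countP_encode]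
    refine wp_minimum _ (w := N.bits) (n := 0) ?_ fun i => wp_seq.2 (wp_clear (wp_seq.2 (wp_push.2
      ⟨?_, wp_seq.2 ?_⟩)))
    · rw [← encodeNat]
      simp only [State.size, List.length_replicate, List.length_nil]
      omega
    · simp only [State.size, State.set, State.get, List.length_replicate, List.length_nil,
        List.length_cons, ofBinary_bits]
      omega
    · rw [ofBinary_bits, Nat.zero_add]
      -- Capping allows the evaluation to take place at `min N (2 ^ S)`, the number now on `col`.
      refine wp_eval_sentence (u := u) (hu.trans (trueAt_alpha_min F N)) ?_
        (wp_seq.2 (wp_clear (wp_clear rfl)))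
      simp only [State.set, List.length_nil]
      omega
  obtain ⟨_, h, rfl⟩ := h
  exact h

theorem Machine.RunsInSpace.mono {M : Machine} {x : List Sym} {s s' : ℕ}
    (h : M.RunsInSpace x s) (hs : s ≤ s') : M.RunsInSpace x s' :=
  fun c hc => (h c hc).trans hs

theorem Cmd.machine_decides {c : Cmd} {x : List Sym} {P : Prop} {B : ℕ}
    (h : ∀ u : Bool, (u = true ↔ P) → Run B c (State.ofInp x []) (State.ofInp [] [.bit u]))
    (hx : x.length ≤ B) : c.machine.Decides x P ∧ c.machine.RunsInSpace x B := by
  refine ⟨⟨fun hP => (Cmd.machine_spec (h true (by simp [hP])) hx).1, fun hP =>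
    (Cmd.machine_spec (h false (by simp [hP])) hx).1⟩, ?_⟩
  by_cases hP : P
  · exact (Cmd.machine_spec (h true (by simp [hP])) hx).2
  · exact (Cmd.machine_spec (h false (by simp [hP])) hx).2

end BAPA

theorem mainTheorem4 :
    -- capping: all stages of the reduction, all nonnegative values of the free variables
    (∀ (F : BAPA.BAFormula 0) (t : ℕ), t ≤ F.numVars → ∀ (N : ℕ) (w : ℕ → ℕ),
      ((F.prenex.stage t).Holds N (fun j => (w j : ℤ)) ↔
        (F.prenex.stage t).Holds N (fun j => ((min (w j) (2 ^ t) : ℕ) : ℤ)))) ∧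
    (∀ (F : BAPA.BAFormula 0) (N : ℕ),
      ((BAPA.alpha F).TrueAt N ↔ (BAPA.alpha F).TrueAt (min N (2 ^ F.numVars)))) ∧
    -- evaluation in small space
    ∃ C : ℕ,
      -- truth of `α(F)` for every size of the universe
      (∃ M : BAPA.Machine, M.FiniteAlphabets ∧ ∀ F : BAPA.BAFormula 0,
        M.Decides F.encode (∀ N : ℕ, (BAPA.alpha F).TrueAt N) ∧
        M.RunsInSpace F.encode (C * (F.size * max F.numVars 1 * 2 ^ F.numVars)) ∧
        M.RunsInSpace F.encode (2 ^ (C * F.size))) ∧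
      -- truth of `α(F)` for a universe of given size
      (∃ M : BAPA.Machine, M.FiniteAlphabets ∧ ∀ (F : BAPA.BAFormula 0) (N : ℕ),
        M.Decides (F.encode ++ BAPA.encodeNat N) ((BAPA.alpha F).TrueAt N) ∧
        M.RunsInSpace (F.encode ++ BAPA.encodeNat N)
          (C * (F.size * max F.numVars 1 * 2 ^ F.numVars + N.size)) ∧
        M.RunsInSpace (F.encode ++ BAPA.encodeNat N) (2 ^ (C * F.size) + C * N.size)) := by
  refine ⟨fun F t ht N w => F.prenex.holds_stage_congr_of_min_eq ht (by simp),
    BAPA.trueAt_alpha_min, 12, ⟨BAPA.Cmd.decideAll.machine, BAPA.Cmd.finiteAlphabets_machine _,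
      fun F => ?_⟩, ⟨BAPA.Cmd.decideAt.machine, BAPA.Cmd.finiteAlphabets_machine _,
      fun F N => ?_⟩⟩
  · have hp : 1 ≤ 2 ^ F.numVars := Nat.one_le_two_pow
    have hB := F.encode_add_le_measure le_rfl
    obtain ⟨h1, h2⟩ := BAPA.Cmd.machine_decides (fun u hu => BAPA.run_decideAll F hu) (by omega)
    exact ⟨h1, h2, h2.mono F.measure_le_two_pow⟩
  · have hp : 1 ≤ 2 ^ F.numVars := Nat.one_le_two_pow
    have hB := F.encode_add_le_measure le_rfl
    have hE := F.measure_le_two_pow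
    obtain ⟨h1, h2⟩ := BAPA.Cmd.machine_decides (fun u hu => BAPA.run_decideAt F N hu) (by
      rw [List.length_append, BAPA.encodeNat, List.length_map, ← Nat.size_eq_bits_len]
      omega)
    refine ⟨h1, h2.mono ?_, h2.mono (by omega)⟩
    rw [Nat.mul_add]
    exact Nat.add_le_add_left (by omega) _
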